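/- Let $\mu>0$ and $0<\gamma_{\mathrm m}\le 2$. Consider, for $(\Sigma_{\mathrm{YM}},X_1,X_2,T)\in\mathbb R^4$, the system \begin{align*} \frac{d\Sigma_{\mathrm{YM}}}{d\bar\tau}&=-\left[(1-q)(1-T)^2\Sigma_{\mathrm{YM}}+2(1-T)TX_1^3+\mu T^2X_2\right],\\ \frac{dX_1}{d\bar\tau}&=-\tfrac12\left[(1-q)(1-T)^2X_1-2(1-T)T\Sigma_{\mathrm{YM}}\right],\\ \frac{dX_2}{d\bar\tau}&=q(1-T)^2X_2+\mu T^2\Sigma_{\mathrm{YM}},\qquad \frac{dT}{d\bar\tau}=\tfrac12(1+q)(1-T)^3T, \end{align*} subject to the constraint $(1-T)X_2=\mu TX_1$, where $$\Omega_{\mathrm{YM}}=\Sigma_{\mathrm{YM}}^2+X_1^4+X_2^2,\qquad \Omega_{\mathrm m}=1-\Omega_{\mathrm{YM}},\qquad q=1-X_2^2+\tfrac32\left(\gamma_{\mathrm m}-\tfrac43\right)\Omega_{\mathrm m}$$ (flat Robertson--Walker cosmologies with a massive Yang--Mills field and a perfect fluid with adiabatic index $\gamma_{\mathrm m}$). By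 a solution we mean a solution of this constrained system with $0<T<1$ and $0<\Omega_{\mathrm m}<1$, defined at least on some half-line $[\bar\tau_0,\infty)$. Let $\mathrm{FL}_1$ be the point $\Sigma_{\mathrm{YM}}=X_1=X_2=0$, $T=1$ (where $\Omega_{\mathrm m}=1$) and, for $0<\omega\le1$, let $\mathcal P_\omega$ be the periodic orbit $\{T=1,\ X_1=0,\ \Sigma_{\mathrm{YM}}^2+X_2^2=\omega\}$ of the boundary $T=1$; on the outer periodic orbit $\mathcal P_1$ one has $\Omega_{\mathrm m}=0$, and the $\mathcal P_\omega$ with $0<\omega<1$ are the inner ones. A solution converges to $\mathcal P_\omega$ if its distance to $\mathcal P_\omega$ tends to $0$ as $\bar\tau\to+\infty$. Through each point that satisfies the constraint, $0<T<1$ and $0<\Omega_{\mathrm m}<1$ there is a solution defined for all $\bar\tau\in\mathbb R$. Moreover, as $\bar\tau\to+\infty$: (i) if $\gamma_{\mathrm m}>1$, then all solutions converge to $\mathcal P_1$; (ii) if $\gamma_{\mathrm m}<1$, then all solutions converge to $\mathrm{FL}_1$; (iii) if $\gamma_{\mathrm m}=1$, then for each $\omega\in(0,1)$ a 1-parameter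 set of solutions converges to $\mathcal P_\omega$. Precisely, there is a family of solutions $x_\theta:\mathbb R\to\mathbb R^4$, with $\theta$ in the unit circle and $(\theta,\bar\tau)\mapsto x_\theta(\bar\tau)$ continuous, such that every $x_\theta$ converges to $\mathcal P_\omega$, and such that for every solution $x$ on a half-line $[\bar\tau_0,\infty)$ that converges to $\mathcal P_\omega$ there is exactly one pair $(\theta,s)$ with $x(\bar\tau)=x_\theta(\bar\tau+s)$ for all $\bar\tau\ge\bar\tau_0$. -/

import Mathlib

open Set Filter Topology

namespace MassiveYM

/-- A state `(Σ_YM, X₁, X₂, T)`; the topology is that of `ℝ⁴`. -/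
abbrev State : Type := ℝ × ℝ × ℝ × ℝ

/-- The variable `Σ_YM`. -/
def sigma (p : State) : ℝ := p.1

/-- The variable `X₁`. -/
def X₁ (p : State) : ℝ := p.2.1

/-- The variable `X₂`. -/
def X₂ (p : State) : ℝ := p.2.2.1

/-- The variable `T`. -/
def T (p : State) : ℝ := p.2.2.2

/-- `Ω_YM = Σ_YM² + X₁⁴ + X₂²`. -/
def OmegaYM (p : State) : ℝ := sigma p ^ 2 + X₁ p ^ 4 + X₂ p ^ 2

/-- `Ω_m = 1 - Ω_YM`. -/
def OmegaM (p : State) : ℝ := 1 - OmegaYM p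

/-- The deceleration parameter `q`, for the adiabatic index `γ = γ_m`. -/
noncomputable def q (γ : ℝ) (p : State) : ℝ :=
  1 - X₂ p ^ 2 + 3 / 2 * (γ - 4 / 3) * OmegaM p

/-- The right-hand side of the evolution equations for `(Σ_YM, X₁, X₂, T)`. -/
noncomputable def field (μ γ : ℝ) (p : State) : State :=
  ( -((1 - q γ p) * (1 - T p) ^ 2 * sigma p + 2 * (1 - T p) * T p * X₁ p ^ 3
        + μ * T p ^ 2 * X₂ p),
    -(1 / 2) * ((1 - q γ p) * (1 - T p) ^ 2 * X₁ p - 2 * (1 - T p) * T p * sigma p),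
    q γ p * (1 - T p) ^ 2 * X₂ p + μ * T p ^ 2 * sigma p,
    1 / 2 * (1 + q γ p) * (1 - T p) ^ 3 * T p )

/-- The part `0 < Ω_m < 1` of the state space: the constraint `(1 - T) X₂ = μ T X₁` holds and
`0 < T < 1`. -/
def twoFluidStates (μ : ℝ) : Set State :=
  {p | (1 - T p) * X₂ p = μ * T p * X₁ p ∧ 0 < T p ∧ T p < 1 ∧ 0 < OmegaM p ∧ OmegaM p < 1}

/-- `x` is, on the time set `I` (here `[τ₀, ∞)` or `ℝ`), a solution of the constrained system
with `0 < Ω_m < 1`. -/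
def IsSolutionOn (μ γ : ℝ) (x : ℝ → State) (I : Set ℝ) : Prop :=
  ∀ τ ∈ I, x τ ∈ twoFluidStates μ ∧ HasDerivWithinAt x (field μ γ (x τ)) I τ

/-- The periodic orbit `P_ω` on the boundary `T = 1` (on which `X₁ = 0`), given by `Ω_YM = ω`. -/
def periodicOrbit (ω : ℝ) : Set State :=
  {p | T p = 1 ∧ X₁ p = 0 ∧ sigma p ^ 2 + X₂ p ^ 2 = ω}

/-- The fixed point `FL₁`: `Σ_YM = X₁ = X₂ = 0`, `T = 1`. -/
def FL₁ : State := (0, 0, 0, 1)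

/-- `x` converges, as time tends to `+∞`, to the (compact nonempty) set `P`: its distance to `P`
tends to `0`. -/
def ConvergesToOrbit (x : ℝ → State) (P : Set State) : Prop :=
  Tendsto (fun τ => Metric.infDist (x τ) P) atTop (𝓝 0)

/-- `X` is a continuous parametrization, by one parameter `θ` on the circle, of the set of all
solutions that converge to `P`. Each `X θ` is such a solution, defined for all times, and each such
solution on a half-line `[τ₀, ∞)` is, up to a translation of time, `X θ` for one and only one `θ`
(the translation being unique too). -/
def IsOneParameterSet (μ γ : ℝ) (P : Set State) (X : Circle → ℝ → State) : Prop :=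
  Continuous (fun z : Circle × ℝ => X z.1 z.2) ∧
  (∀ θ : Circle, IsSolutionOn μ γ (X θ) univ ∧ ConvergesToOrbit (X θ) P) ∧
  ∀ (τ₀ : ℝ) (x : ℝ → State), IsSolutionOn μ γ x (Ici τ₀) → ConvergesToOrbit x P →
    ∃! z : Circle × ℝ, ∀ τ ∈ Ici τ₀, x τ = X z.1 (τ + z.2)

end MassiveYM

/-!
Along solutions `Ω = Ω_YM` obeys `Ω' = (1 - T)² (1 - Ω) (2 X₂² + (3 γ - 4) Ω)`, while `T` increases
to `1`, so slowly that `∫ (1 - T)² dτ` diverges. Near `T = 1` the pair `(Σ_YM, X₂)` rotates with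
frequency `μ`, so that on average `2 X₂²` is `Ω`, and the averaged drift of `log (Ω / (1 - Ω))` is
`3 (γ - 1) (1 - T)²`. The averaging is carried out by adding to this logarithm the small multiple
`((1 - T) / T)² Σ_YM X₂ / (μ Ω)` of the oscillating term (`hasDerivAt_averagedLogit`). For `γ > 1`
this forces `Ω → 1`, for `γ < 1` it forces `Ω → 0`. Global solutions exist because the field,
composed with a retraction onto a box, is bounded and Lipschitz, and the states with `0 < T < 1`,
`Ω_m > 0` are invariant (`mem_fluidStates_of_clamp`).

For `γ = 1` the drift vanishes to leading order. In the cosmic time `t`, `dt = T² dτ`, and in the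
variables `u = Σ_YM / √Ω_m`, `v = X₂ / √Ω_m`, `b = ((1 - T) / T)² √Ω_m` the system becomes a
harmonic oscillator of fixed frequency `μ`, once `u` is replaced by `p = u + H v / (2 μ)` with
`H = ((1 - T) / T)²`, and with a perturbation of order `b²`; and `b` decays like `1 / t`. Hence
`e^(-iμt) (p + i v)` has a limit `ζ`, and `Ω_YM / Ω_m` tends to `|ζ|²`: a solution converges to
`P_ω` exactly if `|ζ|² = ω / (1 - ω)`. The function `b` decreases strictly from `∞` to `0`, so every
solution crosses a section `b = β` exactly once. If `β` is small, the map from the section, with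
coordinates `u + i v`, to `ζ` differs from the identity by a map with Lipschitz constant `1 / 2` on
a large disc (`IsCosmicSolution.exists_threshold`); this works in cosmic time because there the
oscillators have the same frequency, and the phases of two solutions do not drift apart. By the
contraction principle the circle of the `ζ` with `|ζ|² = ω / (1 - ω)` has as its preimage a
continuously parametrized circle, and `IsCosmicSolution.initial_sq_add_sq_le` shows that no
converging solution crosses the section outside the disc.
-/

namespace MassiveYM

variable {μ γ : ℝ}

/-! ### Global solutions of bounded Lipschitz vector fields -/

/-- A bounded Lipschitz vector field on a Banach space has global integral curves. -/
theorem exists_integralCurve_of_lipschitz_of_bounded {E : Type*} [NormedAddCommGroup E]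
    [NormedSpace ℝ E] [CompleteSpace E] {f : E → E} {K L : NNReal} (hf : LipschitzWith K f)
    (hL : ∀ x, ‖f x‖ ≤ L) (x₀ : E) :
    ∃ x : ℝ → E, x 0 = x₀ ∧ ∀ t, HasDerivAt x (f (x t)) t := by
  have loc : ∀ n : ℕ, ∃ x : ℝ → E, x 0 = x₀ ∧
      ∀ t ∈ Ioo (-(n + 1 : ℝ)) (n + 1), HasDerivAt x (f (x t)) t := by
    intro n
    have hn : (0 : ℝ) ≤ n := n.cast_nonneg
    have h0 : (0 : ℝ) ∈ Icc (-(n + 1 : ℝ)) (n + 1) := ⟨by linarith, by linarith⟩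
    have hP : IsPicardLindelof (fun _ => f) (⟨0, h0⟩ : Icc (-(n + 1 : ℝ)) (n + 1)) x₀
        (L * (n + 1)) 0 L K := by
      apply IsPicardLindelof.of_time_independent
      · exact fun x _ => hL x
      · exact hf.lipschitzOnWith
      · simp
    obtain ⟨x, hx0, hx⟩ := hP.exists_eq_forall_mem_Icc_hasDerivWithinAt₀
    refine ⟨x, hx0, fun t ht => (hx t (Ioo_subset_Icc_self ht)).hasDerivAt (Icc_mem_nhds ht.1 ht.2)⟩
  choose x hx0 hx using loc
  have agree : ∀ m n : ℕ, m ≤ n → EqOn (x m) (x n) (Ioo (-(m + 1 : ℝ)) (m + 1)) := by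
    intro m n hmn
    have hmn' : (m : ℝ) ≤ n := by exact_mod_cast hmn
    have hm : (0 : ℝ) ≤ m := m.cast_nonneg
    refine ODE_solution_unique_of_mem_Ioo (v := fun _ => f) (s := fun _ => univ) (t₀ := 0) (K := K)
      (fun _ _ => hf.lipschitzOnWith) ⟨by linarith, by linarith⟩ (fun t ht => ⟨hx m t ht, trivial⟩)
      (fun t ht => ⟨hx n t ⟨by linarith [ht.1], by linarith [ht.2]⟩, trivial⟩) ?_
    rw [hx0, hx0]
  have key : ∀ (n : ℕ) (t : ℝ), |t| < n + 1 → x ⌈|t|⌉₊ t = x n t := by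
    intro n t ht
    have h1 : |t| ≤ (⌈|t|⌉₊ : ℝ) := Nat.le_ceil _
    rcases le_total ⌈|t|⌉₊ n with h | h
    · exact agree _ _ h (abs_lt.1 (by linarith))
    · exact (agree _ _ h (abs_lt.1 ht)).symm
  refine ⟨fun t => x ⌈|t|⌉₊ t, by simpa using hx0 0, fun t => ?_⟩
  have h1 : |t| ≤ (⌈|t|⌉₊ : ℝ) := Nat.le_ceil _
  have h2 := hx ⌈|t|⌉₊ t (abs_lt.1 (by linarith))
  refine h2.congr_of_eventuallyEq ?_
  have : ∀ᶠ s in 𝓝 t, |s| < (⌈|t|⌉₊ : ℝ) + 1 :=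
    continuous_abs.continuousAt.eventually (gt_mem_nhds (by linarith))
  filter_upwards [this] with s hs using key _ _ hs

/-! ### The flow of the constrained system -/

/-- The constrained states with `0 < T < 1` and `Ω_m > 0`; in contrast to `twoFluidStates`, those
without Yang--Mills field (`Ω_m = 1`) are included. -/
def fluidStates (μ : ℝ) : Set State :=
  {p | (1 - T p) * X₂ p = μ * T p * X₁ p ∧ 0 < T p ∧ T p < 1 ∧ 0 < OmegaM p}

/-- The box `[-1, 1]⁴`. -/
def box : Set State := Metric.closedBall 0 1

theorem mem_box {p : State} :
    p ∈ box ↔ |sigma p| ≤ 1 ∧ |X₁ p| ≤ 1 ∧ |X₂ p| ≤ 1 ∧ |T p| ≤ 1 := by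
  simp [box, Prod.norm_def, sigma, X₁, X₂, T]

theorem OmegaYM_nonneg (p : State) : 0 ≤ OmegaYM p := by
  unfold OmegaYM; positivity

theorem mem_box_of_OmegaYM_le {p : State} (h : OmegaYM p ≤ 1) (h0 : 0 ≤ T p) (h1 : T p ≤ 1) :
    p ∈ box := by
  unfold OmegaYM at h
  have a : 0 ≤ X₁ p ^ 4 := by positivity
  refine mem_box.2 ⟨abs_le_of_sq_le_sq' ?_ one_pos.le |> abs_le.2,
    abs_le_of_sq_le_sq' ?_ one_pos.le |> abs_le.2, abs_le_of_sq_le_sq' ?_ one_pos.le |> abs_le.2,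
    abs_le.2 ⟨by linarith, h1⟩⟩
  · nlinarith [sq_nonneg (X₂ p)]
  · nlinarith [sq_nonneg (X₂ p), sq_nonneg (sigma p), sq_nonneg (X₁ p ^ 2 - 1)]
  · nlinarith [sq_nonneg (sigma p)]

theorem fluidStates_subset_box : fluidStates μ ⊆ box := fun p hp =>
  mem_box_of_OmegaYM_le (by have := hp.2.2.2; unfold OmegaM at this; linarith) hp.2.1.le hp.2.2.1.le

theorem twoFluidStates_subset : twoFluidStates μ ⊆ fluidStates μ := fun _ hp =>
  ⟨hp.1, hp.2.1, hp.2.2.1, hp.2.2.2.1⟩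

theorem isCompact_box : IsCompact box := isCompact_closedBall _ _

theorem contDiff_field : ContDiff ℝ 1 (field μ γ) := by
  unfold field q OmegaM OmegaYM sigma X₁ X₂ T
  fun_prop

theorem continuous_sigma : Continuous sigma := by unfold sigma; fun_prop
theorem continuous_X₁ : Continuous X₁ := by unfold X₁; fun_prop
theorem continuous_X₂ : Continuous X₂ := by unfold X₂; fun_prop
theorem continuous_T : Continuous T := by unfold T; fun_prop
theorem continuous_OmegaYM : Continuous OmegaYM := by unfold OmegaYM sigma X₁ X₂; fun_prop
theorem continuous_OmegaM : Continuous OmegaM := continuous_const.sub continuous_OmegaYM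
theorem continuous_q : Continuous (q γ) := by
  unfold q OmegaM OmegaYM sigma X₁ X₂; fun_prop

theorem exists_lipschitzOnWith_field (μ γ : ℝ) :
    ∃ K : NNReal, LipschitzOnWith K (field μ γ) box :=
  contDiff_field.locallyLipschitz.locallyLipschitzOn.exists_lipschitzOnWith_of_compact isCompact_box

/-- The coordinatewise retraction of `ℝ⁴` onto `[-1, 1]⁴`. -/
noncomputable def clamp (p : State) : State :=
  (max (-1) (min 1 p.1), max (-1) (min 1 p.2.1), max (-1) (min 1 p.2.2.1),
    max (-1) (min 1 p.2.2.2))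

theorem clamp_mem_box (p : State) : clamp p ∈ box := by
  have h : ∀ r : ℝ, |max (-1) (min 1 r)| ≤ 1 := fun r =>
    abs_le.2 ⟨le_max_left _ _, max_le (by norm_num) (min_le_left _ _)⟩
  exact mem_box.2 ⟨h _, h _, h _, h _⟩

theorem clamp_eq_self {p : State} (hp : p ∈ box) : clamp p = p := by
  have h : ∀ r : ℝ, |r| ≤ 1 → max (-1) (min 1 r) = r := fun r hr => by
    rw [min_eq_right (abs_le.1 hr).2, max_eq_right (abs_le.1 hr).1]
  obtain ⟨h1, h2, h3, h4⟩ := mem_box.1 hp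
  exact Prod.ext (h _ h1) (Prod.ext (h _ h2) (Prod.ext (h _ h3) (h _ h4)))

theorem lipschitzWith_clamp : LipschitzWith 1 clamp := by
  have h : LipschitzWith 1 fun r : ℝ => max (-1) (min 1 r) :=
    (LipschitzWith.id.const_min 1).const_max (-1)
  refine LipschitzWith.of_dist_le_mul fun p p' => ?_
  have h1 := h.dist_le_mul p.1 p'.1
  have h2 := h.dist_le_mul p.2.1 p'.2.1
  have h3 := h.dist_le_mul p.2.2.1 p'.2.2.1
  have h4 := h.dist_le_mul p.2.2.2 p'.2.2.2
  simp only [NNReal.coe_one, one_mul] at *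
  rw [Prod.dist_eq, Prod.dist_eq, Prod.dist_eq, Prod.dist_eq (x := p), Prod.dist_eq (x := p.2),
    Prod.dist_eq (x := p.2.2)]
  exact max_le_max h1 (max_le_max h2 (max_le_max h3 h4))

/-- The components of a solution. The factor `s` allows for a reversal of time. -/
theorem hasDerivWithinAt_components {x : ℝ → State} {s t : ℝ} {I : Set ℝ}
    (h : HasDerivWithinAt x (s • field μ γ (x t)) I t) :
    HasDerivWithinAt (fun t => sigma (x t)) (s * (field μ γ (x t)).1) I t ∧
    HasDerivWithinAt (fun t => X₁ (x t)) (s * (field μ γ (x t)).2.1) I t ∧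
    HasDerivWithinAt (fun t => X₂ (x t)) (s * (field μ γ (x t)).2.2.1) I t ∧
    HasDerivWithinAt (fun t => T (x t)) (s * (field μ γ (x t)).2.2.2) I t := by
  have h1 := hasFDerivAt_fst.comp_hasDerivWithinAt (f := x) t h
  have h2 := hasFDerivAt_snd.comp_hasDerivWithinAt (f := x) t h
  have h21 := hasFDerivAt_fst.comp_hasDerivWithinAt (f := fun t => (x t).2) t h2
  have h22 := hasFDerivAt_snd.comp_hasDerivWithinAt (f := fun t => (x t).2) t h2
  have h221 := hasFDerivAt_fst.comp_hasDerivWithinAt (f := fun t => (x t).2.2) t h22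
  have h222 := hasFDerivAt_snd.comp_hasDerivWithinAt (f := fun t => (x t).2.2) t h22
  exact ⟨h1, h21, h221, h222⟩

theorem hasDerivWithinAt_OmegaM {x : ℝ → State} {s t : ℝ} {I : Set ℝ}
    (h : HasDerivWithinAt x (s • field μ γ (x t)) I t) :
    HasDerivWithinAt (fun t => OmegaM (x t))
      (-s * ((1 - T (x t)) ^ 2 * OmegaM (x t) *
        (2 * X₂ (x t) ^ 2 + (3 * γ - 4) * OmegaYM (x t)))) I t := by
  obtain ⟨h1, h2, h3, h4⟩ := hasDerivWithinAt_components h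
  have := (((h1.pow 2).add (h2.pow 4)).add (h3.pow 2)).const_sub 1
  refine this.congr_deriv ?_
  simp only [field, q, OmegaM, OmegaYM]
  push_cast
  ring

theorem hasDerivWithinAt_constraint {x : ℝ → State} {s t : ℝ} {I : Set ℝ}
    (h : HasDerivWithinAt x (s • field μ γ (x t)) I t) :
    HasDerivWithinAt (fun t => (1 - T (x t)) * X₂ (x t) - μ * T (x t) * X₁ (x t))
      (s * ((1 - T (x t)) ^ 2 * (q γ (x t) - (1 + q γ (x t)) / 2 * T (x t))) *
        ((1 - T (x t)) * X₂ (x t) - μ * T (x t) * X₁ (x t))) I t := by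
  obtain ⟨h1, h2, h3, h4⟩ := hasDerivWithinAt_components h
  have := ((h4.const_sub 1).mul h3).sub ((h4.const_mul μ).mul h2)
  refine this.congr_deriv ?_
  simp only [field]
  ring

/-- `T (1 - T) Ω_m`, which is positive on `fluidStates` and whose logarithmic derivative along
solutions is bounded. -/
def barrier (p : State) : ℝ := T p * (1 - T p) * OmegaM p

/-- The logarithmic derivative of `barrier` along the flow. -/
noncomputable def barrierRate (γ : ℝ) (p : State) : ℝ :=
  (1 + q γ p) / 2 * (1 - T p) ^ 2 * (1 - 2 * T p) -
    (1 - T p) ^ 2 * (2 * X₂ p ^ 2 + (3 * γ - 4) * OmegaYM p)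

theorem hasDerivWithinAt_barrier {x : ℝ → State} {s t : ℝ} {I : Set ℝ}
    (h : HasDerivWithinAt x (s • field μ γ (x t)) I t) :
    HasDerivWithinAt (fun t => barrier (x t)) (s * barrierRate γ (x t) * barrier (x t)) I t := by
  obtain ⟨-, -, -, h4⟩ := hasDerivWithinAt_components h
  have := (h4.mul (h4.const_sub 1)).mul (hasDerivWithinAt_OmegaM h)
  refine this.congr_deriv ?_
  simp only [field, barrier, barrierRate, Pi.mul_apply]
  ring

theorem mem_fluidStates_of_barrier_pos {p : State} (h0 : 0 ≤ T p) (h1 : T p ≤ 1) (h2 : 0 ≤ OmegaM p)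
    (hc : (1 - T p) * X₂ p - μ * T p * X₁ p = 0) (hb : 0 < barrier p) : p ∈ fluidStates μ := by
  unfold barrier at hb
  refine ⟨by linarith, ?_, ?_, ?_⟩
  · exact lt_of_le_of_ne h0 fun h => by simp [← h] at hb
  · exact lt_of_le_of_ne h1 fun h => by simp [h] at hb
  · exact lt_of_le_of_ne h2 fun h => by simp [← h] at hb

/-- Integral curves of the truncated field, in either direction of time, do not leave
`fluidStates`: by continuous induction, `barrier` stays above a decaying exponential. -/
theorem mem_fluidStates_of_clamp {x : ℝ → State} {s : ℝ} (hs : |s| = 1)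
    (hx : ∀ t, HasDerivAt x (s • field μ γ (clamp (x t))) t) (h0 : x 0 ∈ fluidStates μ) {b : ℝ}
    (hb : 0 ≤ b) : x b ∈ fluidStates μ := by
  have hxc : Continuous x := continuous_iff_continuousAt.2 fun t => (hx t).continuousAt
  obtain ⟨K₁, hK₁⟩ := isCompact_box.exists_bound_of_continuousOn (f := barrierRate γ) (by
    unfold barrierRate
    have := @continuous_T; have := @continuous_X₂; have := @continuous_OmegaYM
    have := @continuous_q γ
    fun_prop)
  obtain ⟨K₂, hK₂⟩ := isCompact_box.exists_bound_of_continuousOn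
    (f := fun p => (1 - T p) ^ 2 * (q γ p - (1 + q γ p) / 2 * T p)) (by
    have := @continuous_T; have := @continuous_q γ
    fun_prop)
  let c : ℝ → ℝ := fun t => (1 - T (x t)) * X₂ (x t) - μ * T (x t) * X₁ (x t)
  have hcc : Continuous c := by
    have := continuous_T.comp hxc; have := continuous_X₂.comp hxc; have := continuous_X₁.comp hxc
    simp only [Function.comp_def] at *
    fun_prop
  have hTc : Continuous fun t => T (x t) := continuous_T.comp hxc
  have hOc : Continuous fun t => OmegaM (x t) := continuous_OmegaM.comp hxc
  have hbc : Continuous fun t => barrier (x t) := by unfold barrier; fun_prop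
  let g : ℝ → ℝ := fun t => barrier (x t) * Real.exp (K₁ * t)
  have hgc : Continuous g := by fun_prop
  have hb0 : 0 < barrier (x 0) :=
    mul_pos (mul_pos h0.2.1 (by linarith [h0.2.2.1])) h0.2.2.2
  let A : Set ℝ := {t | 0 ≤ T (x t) ∧ T (x t) ≤ 1 ∧ 0 ≤ OmegaM (x t) ∧ c t = 0 ∧
    barrier (x 0) ≤ g t}
  have hA : IsClosed A :=
    (isClosed_le continuous_const hTc).inter <| (isClosed_le hTc continuous_const).inter <|
      (isClosed_le continuous_const hOc).inter <| (isClosed_eq hcc continuous_const).inter <|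
      isClosed_le continuous_const hgc
  have hmem : ∀ t ∈ A, x t ∈ fluidStates μ := fun t ht =>
    mem_fluidStates_of_barrier_pos ht.1 ht.2.1 ht.2.2.1 ht.2.2.2.1
      (pos_of_mul_pos_left (hb0.trans_le ht.2.2.2.2) (Real.exp_pos _).le)
  have hsub : Icc 0 b ⊆ A := by
    refine IsClosed.Icc_subset_of_forall_exists_gt (hA.inter isClosed_Icc) ?_ ?_
    · refine ⟨h0.2.1.le, h0.2.2.1.le, h0.2.2.2.le, ?_, by simp [g]⟩
      have := h0.1
      simp only [c]; linarith
    · rintro t ⟨htA, ht⟩ y hy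
      have hm := hmem t htA
      have hev : ∀ᶠ r in 𝓝 t, 0 < T (x r) ∧ T (x r) < 1 ∧ 0 < OmegaM (x r) :=
        (hTc.continuousAt.eventually (lt_mem_nhds hm.2.1)).and
          ((hTc.continuousAt.eventually (gt_mem_nhds hm.2.2.1)).and
            (hOc.continuousAt.eventually (lt_mem_nhds hm.2.2.2)))
      obtain ⟨δ, hδ, hball⟩ := Metric.eventually_nhds_iff.1 hev
      obtain ⟨r, hr1, hr2⟩ : ∃ r, t < r ∧ r < min y (t + δ) :=
        exists_between (lt_min hy (by linarith))
      have hreg : ∀ r' ∈ Icc t r, 0 < T (x r') ∧ T (x r') < 1 ∧ 0 < OmegaM (x r') := by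
        intro r' hr'
        refine hball ?_
        rw [Real.dist_eq, abs_of_nonneg (by linarith [hr'.1])]
        linarith [hr'.2, min_le_right y (t + δ)]
      have hbox : ∀ r' ∈ Icc t r, x r' ∈ box := fun r' hr' => by
        obtain ⟨h1, h2, h3⟩ := hreg r' hr'
        exact mem_box_of_OmegaYM_le (by unfold OmegaM at h3; linarith) h1.le h2.le
      have hder : ∀ r' ∈ Icc t r, HasDerivAt x (s • field μ γ (x r')) r' := fun r' hr' => by
        have := hx r'
        rwa [clamp_eq_self (hbox r' hr')] at this
      refine ⟨r, ?_, hr1, hr2.le.trans (min_le_left _ _)⟩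
      have hrr : r ∈ Icc t r := ⟨hr1.le, le_rfl⟩
      refine ⟨(hreg r hrr).1.le, (hreg r hrr).2.1.le, (hreg r hrr).2.2.le, ?_, ?_⟩
      · refine eq_zero_of_abs_deriv_le_mul_abs_self_of_eq_zero_right (K := K₂) (a := t) (b := r)
          (f := c) hcc.continuousOn
          (fun r' hr' => hasDerivWithinAt_constraint
            (hder r' (Ico_subset_Icc_self hr')).hasDerivWithinAt) htA.2.2.2.1 ?_ r hrr
        intro r' hr'
        rw [norm_mul, norm_mul, Real.norm_eq_abs s, hs, one_mul]
        exact mul_le_mul_of_nonneg_right (hK₂ _ (hbox r' (Ico_subset_Icc_self hr')))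
          (norm_nonneg _)
      · have hmono : MonotoneOn g (Icc t r) := by
          refine monotoneOn_of_hasDerivWithinAt_nonneg (convex_Icc _ _) hgc.continuousOn
            (f' := fun r' => (s * barrierRate γ (x r') + K₁) * g r') ?_ ?_
          · intro r' hr'
            have h1 := hasDerivWithinAt_barrier
              (hder r' (interior_subset hr')).hasDerivWithinAt (I := interior (Icc t r))
            have h2 : HasDerivWithinAt (fun r' => Real.exp (K₁ * r'))
                (Real.exp (K₁ * r') * (K₁ * 1)) (interior (Icc t r)) r' :=
              ((hasDerivAt_id r').const_mul K₁).exp.hasDerivWithinAt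
            refine (h1.mul h2).congr_deriv ?_
            simp only [g]; ring
          · intro r' hr'
            have hr'' := interior_subset hr'
            obtain ⟨h1, h2, h3⟩ := hreg r' hr''
            refine mul_nonneg ?_ (mul_nonneg (mul_pos (mul_pos h1 (by linarith)) h3).le
              (Real.exp_pos _).le)
            have h4 := hK₁ _ (hbox r' hr'')
            have h5 : |s * barrierRate γ (x r')| ≤ K₁ := by
              rw [abs_mul, hs, one_mul]; exact h4
            linarith [(abs_le.1 h5).1]
        exact htA.2.2.2.2.trans (hmono ⟨le_rfl, hr1.le⟩ hrr hr1.le)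
  exact hmem b (hsub ⟨hb, le_rfl⟩)

theorem exists_global_solution (μ γ : ℝ) {p : State} (hp : p ∈ fluidStates μ) :
    ∃ x : ℝ → State, x 0 = p ∧ ∀ t, x t ∈ fluidStates μ ∧ HasDerivAt x (field μ γ (x t)) t := by
  obtain ⟨K, hK⟩ := exists_lipschitzOnWith_field μ γ
  obtain ⟨L, hL⟩ := isCompact_box.exists_bound_of_continuousOn
    (contDiff_field (μ := μ) (γ := γ)).continuous.continuousOn
  have hlip : LipschitzWith (K * 1) (field μ γ ∘ clamp) := by
    rw [← lipschitzOnWith_univ]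
    exact hK.comp lipschitzWith_clamp.lipschitzOnWith fun p _ => clamp_mem_box p
  have hbd : ∀ p, ‖(field μ γ ∘ clamp) p‖ ≤ L.toNNReal := fun p =>
    (hL _ (clamp_mem_box p)).trans (Real.le_coe_toNNReal L)
  obtain ⟨x, hx0, hx⟩ := exists_integralCurve_of_lipschitz_of_bounded hlip hbd p
  have hmem : ∀ t, x t ∈ fluidStates μ := by
    intro t
    rcases le_total 0 t with ht | ht
    · refine mem_fluidStates_of_clamp (γ := γ) (s := 1) (by simp) (fun t => ?_) (hx0 ▸ hp) ht
      rw [one_smul]; exact hx t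
    · have := mem_fluidStates_of_clamp (γ := γ) (μ := μ) (x := fun t => x (-t)) (s := -1)
        (by simp) (fun t => ?_) (by simpa [hx0] using hp) (neg_nonneg.2 ht)
      · simpa using this
      · have := (hx (-t)).scomp t (hasDerivAt_neg t)
        exact this
  refine ⟨x, hx0, fun t => ⟨hmem t, ?_⟩⟩
  have := hx t
  rwa [Function.comp_apply, clamp_eq_self (fluidStates_subset_box (hmem t))] at this

/-- The solution through `p ∈ fluidStates μ` at time `0`, defined for all times; for other `p` the
value is the constant `p`. -/
noncomputable def flow (μ γ : ℝ) (p : State) : ℝ → State :=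
  open Classical in
  if hp : p ∈ fluidStates μ then (exists_global_solution μ γ hp).choose else fun _ => p

theorem flow_zero (p : State) : flow μ γ p 0 = p := by
  unfold flow
  split_ifs with hp
  · exact (exists_global_solution μ γ hp).choose_spec.1
  · rfl

theorem flow_mem {p : State} (hp : p ∈ fluidStates μ) (t : ℝ) : flow μ γ p t ∈ fluidStates μ := by
  unfold flow
  rw [dif_pos hp]
  exact ((exists_global_solution μ γ hp).choose_spec.2 t).1

theorem hasDerivAt_flow {p : State} (hp : p ∈ fluidStates μ) (t : ℝ) :
    HasDerivAt (flow μ γ p) (field μ γ (flow μ γ p t)) t := by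
  unfold flow
  rw [dif_pos hp]
  exact ((exists_global_solution μ γ hp).choose_spec.2 t).2

theorem continuous_flow {p : State} (hp : p ∈ fluidStates μ) : Continuous (flow μ γ p) :=
  continuous_iff_continuousAt.2 fun t => (hasDerivAt_flow hp t).continuousAt

theorem exists_dist_flow_le (μ γ : ℝ) : ∃ K : ℝ, ∀ p ∈ fluidStates μ, ∀ p' ∈ fluidStates μ, ∀ t,
    dist (flow μ γ p t) (flow μ γ p' t) ≤ dist p p' * Real.exp (K * |t|) := by
  obtain ⟨K, hK⟩ := exists_lipschitzOnWith_field μ γ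
  refine ⟨K, fun p hp p' hp' t => ?_⟩
  rcases le_total 0 t with ht | ht
  · have := dist_le_of_trajectories_ODE_of_mem (v := fun _ => field μ γ) (s := fun _ => box)
      (f := flow μ γ p) (g := flow μ γ p') (a := 0) (b := t) (δ := dist p p') (K := K)
      (fun _ _ => hK) (continuous_flow hp).continuousOn
      (fun t _ => (hasDerivAt_flow hp t).hasDerivWithinAt)
      (fun t _ => fluidStates_subset_box (flow_mem hp t)) (continuous_flow hp').continuousOn
      (fun t _ => (hasDerivAt_flow hp' t).hasDerivWithinAt)
      (fun t _ => fluidStates_subset_box (flow_mem hp' t)) (by simp [flow_zero]) t ⟨ht, le_rfl⟩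
    rw [sub_zero] at this
    rwa [abs_of_nonneg ht]
  · have hd : ∀ p ∈ fluidStates μ, ∀ t, HasDerivAt (fun t => flow μ γ p (-t))
        (-field μ γ (flow μ γ p (-t))) t := fun p hp t => by
      have := (hasDerivAt_flow (γ := γ) hp (-t)).scomp t (hasDerivAt_neg t)
      simp only [neg_smul, one_smul] at this
      exact this
    have := dist_le_of_trajectories_ODE_of_mem (v := fun _ p => -field μ γ p) (s := fun _ => box)
      (f := fun t => flow μ γ p (-t)) (g := fun t => flow μ γ p' (-t)) (a := 0) (b := -t)
      (δ := dist p p') (K := K)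
      (fun _ _ => hK.neg) ((continuous_flow hp).comp continuous_neg).continuousOn
      (fun t _ => (hd p hp t).hasDerivWithinAt)
      (fun t _ => fluidStates_subset_box (flow_mem hp (-t)))
      ((continuous_flow hp').comp continuous_neg).continuousOn
      (fun t _ => (hd p' hp' t).hasDerivWithinAt)
      (fun t _ => fluidStates_subset_box (flow_mem hp' (-t))) (by simp [flow_zero]) (-t)
      ⟨by linarith, le_rfl⟩
    simpa [abs_of_nonpos ht] using this

theorem continuous_flow_comp {Θ : Type*} [TopologicalSpace Θ] {P : Θ → State} (hP : Continuous P)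
    (hmem : ∀ θ, P θ ∈ fluidStates μ) : Continuous fun z : Θ × ℝ => flow μ γ (P z.1) z.2 := by
  obtain ⟨K, hK⟩ := exists_dist_flow_le μ γ
  refine continuous_iff_continuousAt.2 fun ⟨θ, t⟩ => ?_
  have h1 : Tendsto (fun z : Θ × ℝ => dist (P z.1) (P θ) * Real.exp (K * |z.2|) +
      dist (flow μ γ (P θ) z.2) (flow μ γ (P θ) t)) (𝓝 (θ, t)) (𝓝 0) := by
    have hc := continuous_flow (γ := γ) (hmem θ)
    have : Continuous fun z : Θ × ℝ => dist (P z.1) (P θ) * Real.exp (K * |z.2|) +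
      dist (flow μ γ (P θ) z.2) (flow μ γ (P θ) t) := by fun_prop
    simpa using this.tendsto (θ, t)
  refine tendsto_iff_dist_tendsto_zero.2 (squeeze_zero (fun _ => dist_nonneg) (fun z => ?_) h1)
  exact (dist_triangle _ (flow μ γ (P θ) z.2) _).trans
    (add_le_add_left (hK _ (hmem _) _ (hmem _) _) _)

theorem IsSolutionOn.eq_flow {x : ℝ → State} {τ₀ : ℝ} (hx : IsSolutionOn μ γ x (Ici τ₀)) {τ : ℝ}
    (hτ : τ₀ ≤ τ) : x τ = flow μ γ (x τ₀) (τ - τ₀) := by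
  obtain ⟨K, hK⟩ := exists_lipschitzOnWith_field μ γ
  have hp : x τ₀ ∈ fluidStates μ := twoFluidStates_subset (hx τ₀ self_mem_Ici).1
  have hd : ∀ t, HasDerivAt (fun t => flow μ γ (x τ₀) (t - τ₀))
      (field μ γ (flow μ γ (x τ₀) (t - τ₀))) t := fun t =>
    (hasDerivAt_flow hp (t - τ₀)).comp_sub_const t τ₀
  exact ODE_solution_unique_of_mem_Icc_right (v := fun _ => field μ γ) (s := fun _ => box)
    (K := K) (f := x) (g := fun t => flow μ γ (x τ₀) (t - τ₀)) (a := τ₀) (b := τ) (fun _ _ => hK)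
    (fun t ht => ((hx t ht.1).2.mono Icc_subset_Ici_self).continuousWithinAt)
    (fun t ht => (hx t ht.1).2.mono (Ici_subset_Ici.2 ht.1))
    (fun t ht => fluidStates_subset_box (twoFluidStates_subset (hx t ht.1).1))
    (fun t _ => (hd t).continuousAt.continuousWithinAt)
    (fun t _ => (hd t).hasDerivWithinAt)
    (fun t _ => fluidStates_subset_box (flow_mem hp _)) (by simp [flow_zero]) ⟨hτ, le_rfl⟩

theorem flow_add {p : State} (hp : p ∈ fluidStates μ) (s t : ℝ) :
    flow μ γ (flow μ γ p s) t = flow μ γ p (s + t) := by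
  obtain ⟨K, hK⟩ := exists_lipschitzOnWith_field μ γ
  have := ODE_solution_unique_univ (v := fun _ => field μ γ) (s := fun _ => box) (t₀ := 0)
    (K := K) (f := flow μ γ (flow μ γ p s)) (g := fun t => flow μ γ p (s + t)) (fun _ => hK)
    (fun t => ⟨hasDerivAt_flow (flow_mem hp s) t,
      fluidStates_subset_box (flow_mem (flow_mem hp s) t)⟩)
    (fun t => ⟨(hasDerivAt_flow hp (s + t)).comp_const_add s t,
      fluidStates_subset_box (flow_mem hp _)⟩) (by simp [flow_zero])
  exact congrFun this t

theorem hasDerivAt_OmegaM_flow {p : State} (hp : p ∈ fluidStates μ) (t : ℝ) :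
    HasDerivAt (fun t => OmegaM (flow μ γ p t))
      (-((1 - T (flow μ γ p t)) ^ 2 * OmegaM (flow μ γ p t) *
        (2 * X₂ (flow μ γ p t) ^ 2 + (3 * γ - 4) * OmegaYM (flow μ γ p t)))) t := by
  have := hasDerivWithinAt_OmegaM (s := 1) (I := univ) (γ := γ) (μ := μ)
    (by rw [one_smul]; exact (hasDerivAt_flow hp t).hasDerivWithinAt)
  simpa only [hasDerivWithinAt_univ, neg_mul, one_mul] using this

theorem OmegaYM_le_one {p : State} (hp : p ∈ fluidStates μ) : OmegaYM p ≤ 1 := by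
  have := hp.2.2.2; unfold OmegaM at this; linarith

theorem OmegaM_le_one (p : State) : OmegaM p ≤ 1 := by
  have := OmegaYM_nonneg p; unfold OmegaM; linarith

theorem X₂_sq_le (p : State) : X₂ p ^ 2 ≤ OmegaYM p := by
  unfold OmegaYM
  have : 0 ≤ X₁ p ^ 4 := by positivity
  nlinarith [sq_nonneg (sigma p)]

theorem OmegaYM_pos_flow {p : State} (hp : p ∈ fluidStates μ) (h0 : 0 < OmegaYM p) (t : ℝ) :
    0 < OmegaYM (flow μ γ p t) := by
  set x := flow μ γ p
  obtain ⟨K, hK⟩ : ∃ K, K = 2 + |3 * γ - 4| := ⟨_, rfl⟩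
  have hd : ∀ t, HasDerivAt (fun t => OmegaYM (x t)) ((1 - T (x t)) ^ 2 * OmegaM (x t) *
      (2 * X₂ (x t) ^ 2 + (3 * γ - 4) * OmegaYM (x t))) t := fun t => by
    have := (hasDerivAt_OmegaM_flow (γ := γ) hp t).const_sub 1
    simpa [OmegaM] using this
  have hbd : ∀ t, |(1 - T (x t)) ^ 2 * OmegaM (x t) *
      (2 * X₂ (x t) ^ 2 + (3 * γ - 4) * OmegaYM (x t))| ≤ K * OmegaYM (x t) := fun t => by
    have hm : x t ∈ fluidStates μ := flow_mem hp t
    have h1 : (1 - T (x t)) ^ 2 ≤ 1 := by nlinarith [hm.2.1, hm.2.2.1]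
    have h2 : |(1 - T (x t)) ^ 2 * OmegaM (x t)| ≤ 1 := by
      rw [abs_of_nonneg (mul_nonneg (sq_nonneg _) hm.2.2.2.le)]
      exact mul_le_one₀ h1 hm.2.2.2.le (OmegaM_le_one _)
    have h3 : |2 * X₂ (x t) ^ 2 + (3 * γ - 4) * OmegaYM (x t)| ≤ K * OmegaYM (x t) := by
      refine (abs_add_le _ _).trans ?_
      rw [abs_mul (3 * γ - 4), abs_of_nonneg (OmegaYM_nonneg _), hK,
        abs_of_nonneg (by positivity)]
      linarith [X₂_sq_le (x t)]
    rw [abs_mul]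
    exact (mul_le_of_le_one_left (abs_nonneg _) h2).trans h3
  have he : ∀ c t : ℝ, HasDerivAt (fun t => OmegaYM (x t) * Real.exp (c * t))
      (((1 - T (x t)) ^ 2 * OmegaM (x t) * (2 * X₂ (x t) ^ 2 + (3 * γ - 4) * OmegaYM (x t)) +
        c * OmegaYM (x t)) * Real.exp (c * t)) t := fun c t => by
    refine ((hd t).mul ((hasDerivAt_id t).const_mul c).exp).congr_deriv ?_
    simp only [id]; ring
  have h0' : 0 < OmegaYM (x 0) := by simpa [x, flow_zero] using h0
  refine pos_of_mul_pos_left (b := Real.exp ((if 0 ≤ t then K else -K) * t)) ?_ (Real.exp_pos _).le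
  refine h0'.trans_le ?_
  split_ifs with ht
  · have : Monotone fun t => OmegaYM (x t) * Real.exp (K * t) :=
      monotone_of_deriv_nonneg (fun t => (he K t).differentiableAt) fun t => by
        rw [(he K t).deriv]
        exact mul_nonneg (by linarith [(abs_le.1 (hbd t)).1]) (Real.exp_pos _).le
    simpa using this ht
  · have : Antitone fun t => OmegaYM (x t) * Real.exp (-K * t) :=
      antitone_of_deriv_nonpos (fun t => (he (-K) t).differentiableAt) fun t => by
        rw [(he (-K) t).deriv]
        exact mul_nonpos_of_nonpos_of_nonneg (by linarith [(abs_le.1 (hbd t)).2])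
          (Real.exp_pos _).le
    simpa using this (not_le.1 ht).le

theorem mem_twoFluidStates_iff {p : State} :
    p ∈ twoFluidStates μ ↔ p ∈ fluidStates μ ∧ 0 < OmegaYM p := by
  simp only [twoFluidStates, fluidStates, mem_ofPred_eq, OmegaM]
  constructor
  · rintro ⟨h1, h2, h3, h4, h5⟩; exact ⟨⟨h1, h2, h3, h4⟩, by linarith⟩
  · rintro ⟨⟨h1, h2, h3, h4⟩, h5⟩; exact ⟨h1, h2, h3, h4, by linarith⟩

theorem isSolutionOn_flow {p : State} (hp : p ∈ twoFluidStates μ) :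
    IsSolutionOn μ γ (flow μ γ p) univ := fun t _ => by
  obtain ⟨h1, h2⟩ := mem_twoFluidStates_iff.1 hp
  exact ⟨mem_twoFluidStates_iff.2 ⟨flow_mem h1 t, OmegaYM_pos_flow h1 h2 t⟩,
    (hasDerivAt_flow h1 t).hasDerivWithinAt⟩

/-! ### The approach to the boundary `T = 1` -/

/-- The variable `(1 - T) / T`; its square is the Hubble variable. -/
noncomputable def lapse (p : State) : ℝ := (1 - T p) / T p

theorem one_add_q_eq (p : State) :
    1 + q γ p = 2 * OmegaYM p - X₂ p ^ 2 + 3 / 2 * γ * OmegaM p := by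
  unfold q OmegaM; ring

theorem one_add_q_ge {p : State} (hp : p ∈ fluidStates μ) : min 1 (3 / 2 * γ) ≤ 1 + q γ p := by
  have h1 := X₂_sq_le p
  have h2 := hp.2.2.2
  have h3 : OmegaYM p = 1 - OmegaM p := by unfold OmegaM; ring
  have h4 := OmegaYM_nonneg p
  have h5 : min 1 (3 / 2 * γ) =
      min 1 (3 / 2 * γ) * OmegaYM p + min 1 (3 / 2 * γ) * OmegaM p := by rw [h3]; ring
  rw [one_add_q_eq, h5]
  linarith [mul_le_mul_of_nonneg_right (min_le_left 1 (3 / 2 * γ)) h4,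
    mul_le_mul_of_nonneg_right (min_le_right 1 (3 / 2 * γ)) h2.le]

theorem one_add_q_pos (hγ : 0 < γ) {p : State} (hp : p ∈ fluidStates μ) : 0 < 1 + q γ p :=
  (lt_min one_pos (by linarith)).trans_le (one_add_q_ge hp)

theorem one_add_q_le (hγ' : γ ≤ 2) {p : State} (hp : p ∈ fluidStates μ) : 1 + q γ p ≤ 3 := by
  have h2 := hp.2.2.2
  have h3 : OmegaYM p = 1 - OmegaM p := by unfold OmegaM; ring
  have h4 := OmegaYM_nonneg p
  rw [one_add_q_eq]
  nlinarith [sq_nonneg (X₂ p)]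

theorem lapse_pos {p : State} (hp : p ∈ fluidStates μ) : 0 < lapse p :=
  div_pos (by linarith [hp.2.2.1]) hp.2.1

theorem X₁_eq (hμ : 0 < μ) {p : State} (hp : p ∈ fluidStates μ) :
    X₁ p = lapse p * X₂ p / μ := by
  have := hp.1
  have := hp.2.1
  unfold lapse
  field_simp
  linarith

theorem T_eq {p : State} (hp : p ∈ fluidStates μ) : T p = (1 + lapse p)⁻¹ := by
  have := hp.2.1
  unfold lapse
  field_simp
  ring

theorem hasDerivAt_flow_components {p : State} (hp : p ∈ fluidStates μ) (t : ℝ) :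
    HasDerivAt (fun t => sigma (flow μ γ p t)) (field μ γ (flow μ γ p t)).1 t ∧
    HasDerivAt (fun t => X₁ (flow μ γ p t)) (field μ γ (flow μ γ p t)).2.1 t ∧
    HasDerivAt (fun t => X₂ (flow μ γ p t)) (field μ γ (flow μ γ p t)).2.2.1 t ∧
    HasDerivAt (fun t => T (flow μ γ p t)) (field μ γ (flow μ γ p t)).2.2.2 t := by
  have := hasDerivWithinAt_components (s := 1) (I := univ) (γ := γ) (μ := μ)
    (by rw [one_smul]; exact (hasDerivAt_flow hp t).hasDerivWithinAt)
  simpa only [hasDerivWithinAt_univ, one_mul] using this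

theorem hasDerivAt_lapse_flow {p : State} (hp : p ∈ fluidStates μ) (t : ℝ) :
    HasDerivAt (fun t => lapse (flow μ γ p t))
      (-((1 + q γ (flow μ γ p t)) / 2 * (1 - T (flow μ γ p t)) ^ 2 * lapse (flow μ γ p t))) t := by
  have h4 := (hasDerivAt_flow_components (γ := γ) hp t).2.2.2
  have hT := (flow_mem (γ := γ) hp t).2.1
  refine ((h4.const_sub 1).div h4 hT.ne').congr_deriv ?_
  simp only [field, lapse]
  field_simp
  ring

theorem monotone_T_flow (hγ : 0 < γ) {p : State} (hp : p ∈ fluidStates μ) :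
    Monotone fun t => T (flow μ γ p t) :=
  monotone_of_deriv_nonneg
    (fun t => (hasDerivAt_flow_components (γ := γ) hp t).2.2.2.differentiableAt) fun t => by
    have hm := flow_mem (γ := γ) hp t
    rw [(hasDerivAt_flow_components (γ := γ) hp t).2.2.2.deriv]
    have := one_add_q_pos hγ hm
    have : 0 < 1 - T (flow μ γ p t) := by linarith [hm.2.2.1]
    have := hm.2.1
    simp only [field]
    positivity

/-- `(1 - T) / T` tends to `0`, because the derivative of its inverse square is bounded below. -/
theorem tendsto_lapse_flow (hγ : 0 < γ) {p : State} (hp : p ∈ fluidStates μ) :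
    Tendsto (fun t => lapse (flow μ γ p t)) atTop (𝓝 0) := by
  set x := flow μ γ p with hx
  have hm : ∀ t, x t ∈ fluidStates μ := flow_mem hp
  obtain ⟨c, hc⟩ : ∃ c, c = min 1 (3 / 2 * γ) * T (x 0) ^ 2 := ⟨_, rfl⟩
  have hmin : 0 < min 1 (3 / 2 * γ) := lt_min one_pos (by linarith)
  have hcpos : 0 < c := by
    rw [hc]; exact mul_pos hmin (pow_pos (hm 0).2.1 2)
  have hd : ∀ t, HasDerivAt (fun t => (lapse (x t) ^ 2)⁻¹ - c * t)
      ((1 + q γ (x t)) * T (x t) ^ 2 - c) t := fun t => by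
    have hl := lapse_pos (hm t)
    have hT := (hm t).2.1
    refine ((((hasDerivAt_lapse_flow (γ := γ) hp t).pow 2).inv (pow_pos hl 2).ne').sub
      ((hasDerivAt_id t).const_mul c)).congr_deriv ?_
    have hl' : lapse (x t) = (1 - T (x t)) / T (x t) := rfl
    have hT1 : (1 - T (x t)) ≠ 0 := by linarith [(hm t).2.2.1]
    simp only [Pi.pow_apply, ← hx]
    rw [hl']
    push_cast
    field_simp
  have hmono : MonotoneOn (fun t => (lapse (x t) ^ 2)⁻¹ - c * t) (Ici 0) := by
    refine monotoneOn_of_hasDerivWithinAt_nonneg (convex_Ici _)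
      (fun t _ => (hd t).continuousAt.continuousWithinAt) (fun t _ => (hd t).hasDerivWithinAt) ?_
    intro t ht
    rw [interior_Ici] at ht
    have h1 : T (x 0) ^ 2 ≤ T (x t) ^ 2 :=
      pow_le_pow_left₀ (hm 0).2.1.le (monotone_T_flow hγ hp (le_of_lt ht)) 2
    rw [hc, sub_nonneg]
    exact mul_le_mul (one_add_q_ge (hm t)) h1 (sq_nonneg _) (one_add_q_pos hγ (hm t)).le
  have hinv : Tendsto (fun t => (lapse (x t) ^ 2)⁻¹) atTop atTop := by
    refine tendsto_atTop_mono' _ ?_ (tendsto_id.const_mul_atTop hcpos)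
    filter_upwards [eventually_ge_atTop 0] with t ht
    have := hmono (self_mem_Ici : (0 : ℝ) ∈ Ici 0) ht ht
    have h0 : 0 ≤ (lapse (x 0) ^ 2)⁻¹ := by positivity
    simp only [mul_zero, sub_zero, id] at this ⊢
    linarith
  have h2 := (tendsto_inv_atTop_zero.comp hinv).sqrt
  simp only [Function.comp_def, inv_inv, Real.sqrt_zero] at h2
  exact h2.congr fun t => Real.sqrt_sq (lapse_pos (hm t)).le

theorem tendsto_T_of_lapse {x : ℝ → State} (hx : ∀ᶠ t in atTop, x t ∈ fluidStates μ)
    (h : Tendsto (fun t => lapse (x t)) atTop (𝓝 0)) : Tendsto (fun t => T (x t)) atTop (𝓝 1) := by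
  have : Tendsto (fun t => (1 + lapse (x t))⁻¹) atTop (𝓝 (1 + 0)⁻¹) :=
    (h.const_add 1).inv₀ (by norm_num)
  rw [add_zero, inv_one] at this
  refine this.congr' ?_
  filter_upwards [hx] with t ht using (T_eq ht).symm

theorem tendsto_X₁_of_lapse (hμ : 0 < μ) {x : ℝ → State} (hx : ∀ᶠ t in atTop, x t ∈ fluidStates μ)
    (h : Tendsto (fun t => lapse (x t)) atTop (𝓝 0)) : Tendsto (fun t => X₁ (x t)) atTop (𝓝 0) := by
  have h1 : Tendsto (fun t => lapse (x t) / μ) atTop (𝓝 0) := by simpa using h.div_const μ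
  refine squeeze_zero_norm' ?_ h1
  filter_upwards [hx] with t ht
  rw [X₁_eq hμ ht, Real.norm_eq_abs, abs_div, abs_mul, abs_of_pos hμ, abs_of_pos (lapse_pos ht)]
  have h2 := (mem_box.1 (fluidStates_subset_box ht)).2.2.1
  have h3 := lapse_pos ht
  gcongr
  exact mul_le_of_le_one_right h3.le h2

/-! ### Convergence to the periodic orbits -/

theorem isCompact_periodicOrbit (ω : ℝ) : IsCompact (periodicOrbit ω) := by
  have hc : IsClosed (periodicOrbit ω) :=
    (isClosed_eq continuous_T continuous_const).inter <|
      (isClosed_eq continuous_X₁ continuous_const).inter <|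
      isClosed_eq ((continuous_sigma.pow 2).add (continuous_X₂.pow 2)) continuous_const
  refine Metric.isCompact_of_isClosed_isBounded hc (Metric.isBounded_closedBall.subset
    (?_ : _ ⊆ Metric.closedBall (0 : State) (1 + |ω|)))
  rintro p ⟨h1, h2, h3⟩
  have e1 : |sigma p| ≤ 1 + |ω| := abs_le_of_sq_le_sq (by
    nlinarith [le_abs_self ω, abs_nonneg ω, sq_nonneg (X₂ p)]) (by positivity)
  have e2 : |X₂ p| ≤ 1 + |ω| := abs_le_of_sq_le_sq (by
    nlinarith [le_abs_self ω, abs_nonneg ω, sq_nonneg (sigma p)]) (by positivity)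
  have e3 : |X₁ p| ≤ 1 + |ω| := by rw [h2, abs_zero]; positivity
  have e4 : |T p| ≤ 1 + |ω| := by rw [h1, abs_one]; linarith [abs_nonneg ω]
  rw [mem_closedBall_zero_iff]
  simp only [Prod.norm_def, Real.norm_eq_abs]
  exact max_le e1 (max_le e3 (max_le e2 e4))

theorem convergesToOrbit_of_tendsto {x : ℝ → State} {ω : ℝ} (hω : 0 < ω)
    (hT : Tendsto (fun t => T (x t)) atTop (𝓝 1)) (hX : Tendsto (fun t => X₁ (x t)) atTop (𝓝 0))
    (hO : Tendsto (fun t => OmegaYM (x t)) atTop (𝓝 ω)) :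
    ConvergesToOrbit x (periodicOrbit ω) := by
  have h2 : Tendsto (fun t => sigma (x t) ^ 2 + X₂ (x t) ^ 2) atTop (𝓝 ω) := by
    have := hO.sub (hX.pow 4)
    simp only [ne_eq, OfNat.ofNat_ne_zero, not_false_eq_true, zero_pow, sub_zero] at this
    exact this.congr fun t => by unfold OmegaYM; ring
  have hr := h2.sqrt
  have hlim : Tendsto (fun t => |√(sigma (x t) ^ 2 + X₂ (x t) ^ 2) - √ω| + |X₁ (x t)| +
      |T (x t) - 1|) atTop (𝓝 0) := by
    have := ((hr.sub_const (√ω)).abs.add hX.abs).add (hT.sub_const 1).abs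
    simpa using this
  refine squeeze_zero' (Eventually.of_forall fun _ => Metric.infDist_nonneg) ?_ hlim
  filter_upwards [h2.eventually (lt_mem_nhds hω)] with t ht
  obtain ⟨r, hrdef⟩ : ∃ r, r = √(sigma (x t) ^ 2 + X₂ (x t) ^ 2) := ⟨_, rfl⟩
  have hrpos : 0 < r := hrdef ▸ Real.sqrt_pos.2 ht
  have hr2 : r ^ 2 = sigma (x t) ^ 2 + X₂ (x t) ^ 2 := by rw [hrdef, Real.sq_sqrt ht.le]
  rw [← hrdef]
  let p : State := (sigma (x t) * (√ω / r), 0, X₂ (x t) * (√ω / r), 1)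
  have hp : p ∈ periodicOrbit ω := by
    refine ⟨rfl, rfl, ?_⟩
    change (sigma (x t) * (√ω / r)) ^ 2 + (X₂ (x t) * (√ω / r)) ^ 2 = ω
    have : √ω ^ 2 = ω := Real.sq_sqrt hω.le
    field_simp
    rw [this, hr2]
    ring
  refine (Metric.infDist_le_dist_of_mem hp).trans ?_
  have radial : ∀ y : ℝ, y ^ 2 ≤ r ^ 2 → |y - y * (√ω / r)| ≤ |r - √ω| := fun y hy => by
    have h1 : y - y * (√ω / r) = y / r * (r - √ω) := by field_simp
    have h3 : |y / r| ≤ 1 := by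
      rw [abs_div, abs_of_pos hrpos]
      exact (div_le_one hrpos).2 (abs_le_of_sq_le_sq hy hrpos.le)
    rw [h1, abs_mul]
    exact mul_le_of_le_one_left (abs_nonneg _) h3
  have n1 := abs_nonneg (r - √ω)
  have n2 := abs_nonneg (X₁ (x t))
  have n3 := abs_nonneg (T (x t) - 1)
  simp only [Prod.dist_eq, Real.dist_eq, p]
  refine max_le ?_ (max_le ?_ (max_le ?_ ?_))
  · have := radial (sigma (x t)) (by nlinarith [sq_nonneg (X₂ (x t))])
    exact this.trans (by linarith)
  · change |X₁ (x t) - 0| ≤ _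
    rw [sub_zero]; linarith
  · have := radial (X₂ (x t)) (by nlinarith [sq_nonneg (sigma (x t))])
    exact this.trans (by linarith)
  · change |T (x t) - 1| ≤ _
    linarith

theorem tendsto_OmegaYM_of_convergesToOrbit {x : ℝ → State} {ω : ℝ} (hω : 0 ≤ ω)
    (hx : ConvergesToOrbit x (periodicOrbit ω)) :
    Tendsto (fun t => OmegaYM (x t)) atTop (𝓝 ω) := by
  have hne : (periodicOrbit ω).Nonempty :=
    ⟨(√ω, 0, 0, 1), rfl, rfl, by simp [sigma, X₂, Real.sq_sqrt hω]⟩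
  refine tendsto_nhds.2 fun U hU hωU => ?_
  have hsub : periodicOrbit ω ⊆ OmegaYM ⁻¹' U := by
    rintro p ⟨-, h2, h3⟩
    have : OmegaYM p = ω := by unfold OmegaYM; rw [h2, ← h3]; ring
    rwa [mem_preimage, this]
  obtain ⟨δ, hδ, hsub⟩ := (isCompact_periodicOrbit ω).exists_thickening_subset_open
    (hU.preimage continuous_OmegaYM) hsub
  filter_upwards [hx.eventually (gt_mem_nhds hδ)] with t ht
  exact hsub ((Metric.mem_thickening_iff_infDist_lt hne).2 ht)

/-! ### The averaged equation for `Ω_YM` -/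

/-- The logarithm of `Ω_YM / Ω_m` with a correction that removes the leading oscillation of its
derivative. -/
noncomputable def averagedLogit (μ : ℝ) (p : State) : ℝ :=
  Real.log (OmegaYM p) - Real.log (OmegaM p) + lapse p ^ 2 * (sigma p * X₂ p / OmegaYM p) / μ

/-- The remainder in the averaged equation, up to the factor `(1 - T)² ((1 - T) / T)²`. -/
noncomputable def averagedRest (μ γ : ℝ) (p : State) : ℝ :=
  -3 * (X₁ p ^ 2 * (X₂ p ^ 2 / OmegaYM p)) / μ ^ 2 + sigma p * X₂ p / OmegaYM p / μ *
    (q γ p - 2 - OmegaM p * (2 * (X₂ p ^ 2 / OmegaYM p) + (3 * γ - 4)))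

/-- On average `X₂²` is half of `Ω_YM`, so the averaged drift of `log (Ω_YM / Ω_m)` is
`3 (γ - 1) (1 - T)²`. -/
theorem hasDerivAt_averagedLogit (hμ : 0 < μ) {p : State} (hp : p ∈ fluidStates μ)
    (h0 : 0 < OmegaYM p) (t : ℝ) :
    HasDerivAt (fun t => averagedLogit μ (flow μ γ p t)) ((1 - T (flow μ γ p t)) ^ 2 *
      (3 * (γ - 1) + lapse (flow μ γ p t) ^ 2 * averagedRest μ γ (flow μ γ p t))) t := by
  set x := flow μ γ p with hx
  have hm : x t ∈ fluidStates μ := flow_mem hp t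
  have hO : 0 < OmegaYM (x t) := OmegaYM_pos_flow hp h0 t
  have hw : 0 < OmegaM (x t) := hm.2.2.2
  have hT := hm.2.1
  obtain ⟨h1, h2, h3, h4⟩ := hasDerivAt_flow_components (γ := γ) hp t
  have hdw := hasDerivAt_OmegaM_flow (γ := γ) hp t
  have hdO : HasDerivAt (fun t => OmegaYM (x t)) ((1 - T (x t)) ^ 2 * OmegaM (x t) *
      (2 * X₂ (x t) ^ 2 + (3 * γ - 4) * OmegaYM (x t))) t := by
    have := hdw.const_sub 1
    simpa [OmegaM] using this
  have hd := ((hdO.log hO.ne').sub (hdw.log hw.ne')).add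
    ((((hasDerivAt_lapse_flow (γ := γ) hp t).pow 2).mul ((h1.mul h3).div hdO hO.ne')).div_const μ)
  refine hd.congr_deriv ?_
  simp only [← hx, Pi.mul_apply, Pi.div_apply, Pi.pow_apply, field, averagedRest]
  have hX : X₁ (x t) = lapse (x t) * X₂ (x t) / μ := X₁_eq hμ hm
  have hε : 1 - T (x t) = lapse (x t) * T (x t) := by unfold lapse; field_simp
  have hS : sigma (x t) ^ 2 = OmegaYM (x t) - X₁ (x t) ^ 4 - X₂ (x t) ^ 2 := by
    unfold OmegaYM; ring
  have hwO : OmegaM (x t) = 1 - OmegaYM (x t) := rfl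
  rw [hε]
  rw [hwO] at hw ⊢
  rw [hX] at hS ⊢
  generalize sigma (x t) = S at *
  generalize X₂ (x t) = Y at *
  generalize lapse (x t) = h at *
  generalize q γ (x t) = Q at *
  generalize OmegaYM (x t) = O at *
  generalize T (x t) = τ at *
  have hw' := hw.ne'
  push_cast
  field_simp
  field_simp at hS
  linear_combination h ^ 2 * O * hS

theorem abs_sigma_mul_X₂_div_le (p : State) : |sigma p * X₂ p / OmegaYM p| ≤ 1 := by
  rw [abs_div, abs_of_nonneg (OmegaYM_nonneg p)]
  refine div_le_one_of_le₀ ?_ (OmegaYM_nonneg p)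
  have h : 0 ≤ X₁ p ^ 4 := by positivity
  unfold OmegaYM
  rw [abs_le]
  constructor <;> nlinarith [sq_nonneg (sigma p + X₂ p), sq_nonneg (sigma p - X₂ p),
    sq_nonneg (sigma p), sq_nonneg (X₂ p)]

theorem abs_averagedRest_le (hμ : 0 < μ) (hγ : 0 < γ) (hγ' : γ ≤ 2) {p : State}
    (hp : p ∈ fluidStates μ) : |averagedRest μ γ p| ≤ 3 / μ ^ 2 + 12 / μ := by
  have hj := abs_sigma_mul_X₂_div_le p
  have hk0 : 0 ≤ X₂ p ^ 2 / OmegaYM p := div_nonneg (sq_nonneg _) (OmegaYM_nonneg p)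
  have hk1 : X₂ p ^ 2 / OmegaYM p ≤ 1 := div_le_one_of_le₀ (X₂_sq_le p) (OmegaYM_nonneg p)
  have hX : X₁ p ^ 2 ≤ 1 :=
    (sq_le_one_iff_abs_le_one _).2 (mem_box.1 (fluidStates_subset_box hp)).2.1
  have hw0 := hp.2.2.2
  have hw1 := OmegaM_le_one p
  have hq0 := one_add_q_pos hγ hp
  have hq1 := one_add_q_le hγ' hp
  have hγ'' : |2 * (X₂ p ^ 2 / OmegaYM p) + (3 * γ - 4)| ≤ 4 :=
    abs_le.2 ⟨by linarith, by linarith⟩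
  unfold averagedRest
  refine (abs_add_le _ _).trans (add_le_add ?_ ?_)
  · rw [abs_div, abs_of_pos (pow_pos hμ 2)]
    gcongr
    rw [abs_mul, abs_of_nonneg (a := X₁ p ^ 2 * _) (by positivity)]
    have := mul_le_one₀ hX hk0 hk1
    norm_num
    linarith
  · rw [abs_mul, abs_div, abs_of_pos hμ, div_mul_eq_mul_div]
    gcongr
    have h1 : |q γ p - 2 - OmegaM p * (2 * (X₂ p ^ 2 / OmegaYM p) + (3 * γ - 4))| ≤ 12 := by
      refine (abs_sub _ _).trans ?_
      rw [abs_mul, abs_of_pos hw0]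
      have h2 : |q γ p - 2| ≤ 3 := abs_le.2 ⟨by linarith, by linarith⟩
      have h3 := mul_le_mul hw1 hγ'' (abs_nonneg _) zero_le_one
      linarith
    have := mul_le_mul hj h1 (abs_nonneg _) zero_le_one
    linarith

/-- Comparison: if `f' ≥ c g'` eventually, with `c > 0`, and `g → ∞`, then `f → ∞`. -/
theorem tendsto_atTop_of_hasDerivAt_ge {f g f' g' : ℝ → ℝ} {c : ℝ} (hc : 0 < c)
    (hf : ∀ t, HasDerivAt f (f' t) t) (hg : ∀ t, HasDerivAt g (g' t) t)
    (h : ∀ᶠ t in atTop, c * g' t ≤ f' t) (hlim : Tendsto g atTop atTop) :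
    Tendsto f atTop atTop := by
  obtain ⟨a, ha⟩ := eventually_atTop.1 h
  have hd : ∀ t, HasDerivAt (fun t => f t - c * g t) (f' t - c * g' t) t := fun t =>
    (hf t).sub ((hg t).const_mul c)
  have hmono : MonotoneOn (fun t => f t - c * g t) (Ici a) := by
    refine monotoneOn_of_hasDerivWithinAt_nonneg (convex_Ici _)
      (fun t _ => (hd t).continuousAt.continuousWithinAt) (fun t _ => (hd t).hasDerivWithinAt) ?_
    intro t ht
    rw [interior_Ici] at ht
    exact sub_nonneg.2 (ha t (le_of_lt ht))
  refine tendsto_atTop_mono' _ ?_ (tendsto_atTop_add_const_left _ (f a - c * g a)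
    (hlim.const_mul_atTop hc))
  filter_upwards [eventually_ge_atTop a] with t ht
  have := hmono self_mem_Ici ht ht
  simp only at this
  linarith

theorem tendsto_neg_log_lapse (hγ : 0 < γ) {p : State} (hp : p ∈ fluidStates μ) :
    Tendsto (fun t => -Real.log (lapse (flow μ γ p t))) atTop atTop := by
  have h : Tendsto (fun t => lapse (flow μ γ p t)) atTop (𝓝[>] 0) :=
    tendsto_nhdsWithin_iff.2 ⟨tendsto_lapse_flow hγ hp,
      Eventually.of_forall fun t => lapse_pos (flow_mem hp t)⟩
  exact tendsto_neg_atBot_atTop.comp (Real.tendsto_log_nhdsGT_zero.comp h)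

theorem hasDerivAt_neg_log_lapse {p : State} (hp : p ∈ fluidStates μ) (t : ℝ) :
    HasDerivAt (fun t => -Real.log (lapse (flow μ γ p t)))
      ((1 + q γ (flow μ γ p t)) / 2 * (1 - T (flow μ γ p t)) ^ 2) t := by
  have hl := lapse_pos (flow_mem (γ := γ) hp t)
  refine ((hasDerivAt_lapse_flow (γ := γ) hp t).log hl.ne').neg.congr_deriv ?_
  field_simp

theorem tendsto_sign_mul_averagedLogit (hμ : 0 < μ) (hγ : 0 < γ) (hγ' : γ ≤ 2) {s : ℝ}
    (hs : |s| = 1) (hsγ : 0 < s * (γ - 1)) {p : State} (hp : p ∈ fluidStates μ)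
    (h0 : 0 < OmegaYM p) :
    Tendsto (fun t => s * averagedLogit μ (flow μ γ p t)) atTop atTop := by
  refine tendsto_atTop_of_hasDerivAt_ge hsγ
    (fun t => (hasDerivAt_averagedLogit hμ hp h0 t).const_mul s)
    (fun t => hasDerivAt_neg_log_lapse hp t) ?_ (tendsto_neg_log_lapse hγ hp)
  have hlim : Tendsto (fun t => lapse (flow μ γ p t) ^ 2 * (3 / μ ^ 2 + 12 / μ)) atTop (𝓝 0) := by
    simpa using ((tendsto_lapse_flow hγ hp).pow 2).mul_const (3 / μ ^ 2 + 12 / μ)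
  filter_upwards [hlim.eventually (gt_mem_nhds hsγ)] with t ht
  have hm := flow_mem (γ := γ) hp t
  set x := flow μ γ p t
  have h1 : |s * (lapse x ^ 2 * averagedRest μ γ x)| ≤ s * (γ - 1) := by
    rw [abs_mul, hs, one_mul, abs_mul, abs_of_nonneg (sq_nonneg (lapse x))]
    exact (mul_le_mul_of_nonneg_left (abs_averagedRest_le hμ hγ hγ' hm) (sq_nonneg _)).trans ht.le
  have h2 := mul_le_mul_of_nonneg_left (one_add_q_le hγ' hm) hsγ.le
  have h3 : s * (γ - 1) * (1 + q γ x) / 2 ≤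
      s * (3 * (γ - 1) + lapse x ^ 2 * averagedRest μ γ x) := by
    nlinarith [(abs_le.1 h1).1]
  have h4 := mul_le_mul_of_nonneg_left h3 (sq_nonneg (1 - T x))
  linarith

theorem abs_averagedLogit_sub_le (hμ : 0 < μ) {p : State} :
    |averagedLogit μ p - (Real.log (OmegaYM p) - Real.log (OmegaM p))| ≤ lapse p ^ 2 / μ := by
  unfold averagedLogit
  rw [add_sub_cancel_left, abs_div, abs_mul, abs_of_pos hμ, abs_of_nonneg (sq_nonneg _)]
  gcongr
  exact mul_le_of_le_one_right (sq_nonneg _) (abs_sigma_mul_X₂_div_le p)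

theorem tendsto_sign_mul_logit (hμ : 0 < μ) (hγ : 0 < γ) (hγ' : γ ≤ 2) {s : ℝ}
    (hs : |s| = 1) (hsγ : 0 < s * (γ - 1)) {p : State} (hp : p ∈ fluidStates μ)
    (h0 : 0 < OmegaYM p) :
    Tendsto (fun t => s * (Real.log (OmegaYM (flow μ γ p t)) - Real.log (OmegaM (flow μ γ p t))))
      atTop atTop := by
  have hlim : Tendsto (fun t => lapse (flow μ γ p t) ^ 2 / μ) atTop (𝓝 0) := by
    simpa using ((tendsto_lapse_flow hγ hp).pow 2).div_const μ
  refine tendsto_atTop_mono' _ ?_ (tendsto_atTop_add_const_right _ (-1)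
    (tendsto_sign_mul_averagedLogit hμ hγ hγ' hs hsγ hp h0))
  filter_upwards [hlim.eventually (gt_mem_nhds one_pos)] with t ht
  have h1 := abs_averagedLogit_sub_le hμ (p := flow μ γ p t)
  have h2 : |s * (averagedLogit μ (flow μ γ p t) - (Real.log (OmegaYM (flow μ γ p t)) -
      Real.log (OmegaM (flow μ γ p t))))| ≤ 1 := by
    rw [abs_mul, hs, one_mul]; exact h1.trans ht.le
  rw [mul_sub] at h2
  linarith [(abs_le.1 h2).2]

/-- For `γ > 1` the fluid becomes negligible. -/
theorem tendsto_OmegaYM_one (hμ : 0 < μ) (hγ : 1 < γ) (hγ' : γ ≤ 2) {p : State}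
    (hp : p ∈ fluidStates μ) (h0 : 0 < OmegaYM p) :
    Tendsto (fun t => OmegaYM (flow μ γ p t)) atTop (𝓝 1) := by
  have h := tendsto_sign_mul_logit hμ (one_pos.trans hγ) hγ' (s := 1) (by simp) (by linarith) hp h0
  have he := Real.tendsto_exp_neg_atTop_nhds_zero.comp h
  have hw : Tendsto (fun t => OmegaM (flow μ γ p t)) atTop (𝓝 0) := by
    refine squeeze_zero (fun t => (flow_mem hp t).2.2.2.le) (fun t => ?_) he
    have hw := (flow_mem (γ := γ) hp t).2.2.2
    have hO := OmegaYM_pos_flow (γ := γ) hp h0 t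
    simp only [Function.comp_apply, one_mul, neg_sub]
    rw [Real.exp_sub, Real.exp_log hw, Real.exp_log hO]
    exact le_div_self hw.le hO (OmegaYM_le_one (flow_mem hp t))
  have := hw.const_sub 1
  simpa [OmegaM] using this

/-- For `γ < 1` the Yang--Mills field becomes negligible. -/
theorem tendsto_OmegaYM_zero (hμ : 0 < μ) (hγ : 0 < γ) (hγ' : γ < 1) {p : State}
    (hp : p ∈ fluidStates μ) (h0 : 0 < OmegaYM p) :
    Tendsto (fun t => OmegaYM (flow μ γ p t)) atTop (𝓝 0) := by
  have h := tendsto_sign_mul_logit hμ hγ (by linarith) (s := -1) (by simp) (by linarith) hp h0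
  have he := Real.tendsto_exp_neg_atTop_nhds_zero.comp h
  refine squeeze_zero (fun t => OmegaYM_nonneg _) (fun t => ?_) he
  have hw := (flow_mem (γ := γ) hp t).2.2.2
  have hO := OmegaYM_pos_flow (γ := γ) hp h0 t
  simp only [Function.comp_apply, neg_mul, one_mul, neg_neg]
  rw [Real.exp_sub, Real.exp_log hw, Real.exp_log hO]
  exact le_div_self hO.le hw (OmegaM_le_one _)

theorem IsSolutionOn.eventuallyEq_flow {x : ℝ → State} {τ₀ : ℝ}
    (hx : IsSolutionOn μ γ x (Ici τ₀)) :
    (fun τ => flow μ γ (x τ₀) (τ - τ₀)) =ᶠ[atTop] x := by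
  filter_upwards [eventually_ge_atTop τ₀] with τ hτ using (hx.eq_flow hτ).symm

theorem convergesToOrbit_of_tendsto_flow (hμ : 0 < μ) (hγ : 0 < γ) {ω : ℝ} (hω : 0 < ω)
    {p : State} (hp : p ∈ fluidStates μ)
    (hO : Tendsto (fun t => OmegaYM (flow μ γ p t)) atTop (𝓝 ω)) :
    ConvergesToOrbit (flow μ γ p) (periodicOrbit ω) :=
  have hm := Eventually.of_forall (f := atTop) (flow_mem (γ := γ) hp)
  convergesToOrbit_of_tendsto hω (tendsto_T_of_lapse hm (tendsto_lapse_flow hγ hp))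
    (tendsto_X₁_of_lapse hμ hm (tendsto_lapse_flow hγ hp)) hO

theorem convergesToOrbit_one (hμ : 0 < μ) (hγ : 1 < γ) (hγ' : γ ≤ 2) {x : ℝ → State} {τ₀ : ℝ}
    (hx : IsSolutionOn μ γ x (Ici τ₀)) : ConvergesToOrbit x (periodicOrbit 1) := by
  obtain ⟨hp, h0⟩ := mem_twoFluidStates_iff.1 (hx τ₀ self_mem_Ici).1
  have h : Tendsto _ _ _ := convergesToOrbit_of_tendsto_flow (γ := γ) hμ (by linarith) one_pos hp
    (tendsto_OmegaYM_one hμ hγ hγ' hp h0)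
  refine (h.comp (tendsto_atTop_add_const_right _ (-τ₀) tendsto_id)).congr' ?_
  filter_upwards [hx.eventuallyEq_flow] with τ hτ
  simp only [Function.comp_apply, id, ← sub_eq_add_neg, hτ]

theorem tendsto_FL₁ (hμ : 0 < μ) (hγ : 0 < γ) (hγ' : γ < 1) {x : ℝ → State} {τ₀ : ℝ}
    (hx : IsSolutionOn μ γ x (Ici τ₀)) : Tendsto x atTop (𝓝 FL₁) := by
  obtain ⟨hp, h0⟩ := mem_twoFluidStates_iff.1 (hx τ₀ self_mem_Ici).1
  have hO := tendsto_OmegaYM_zero (γ := γ) hμ hγ hγ' hp h0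
  have hm := Eventually.of_forall (f := atTop) (flow_mem (γ := γ) hp)
  have hl := tendsto_lapse_flow hγ hp
  have hsq : ∀ f : State → ℝ, (∀ p, f p ^ 2 ≤ OmegaYM p) →
      Tendsto (fun t => f (flow μ γ (x τ₀) t)) atTop (𝓝 0) := fun f hf => by
    have h1 := hO.sqrt
    rw [Real.sqrt_zero] at h1
    exact squeeze_zero_norm (fun t => Real.abs_le_sqrt (hf _)) h1
  have hS := hsq sigma fun p => by
    unfold OmegaYM; nlinarith [sq_nonneg (X₂ p), sq_nonneg (X₁ p ^ 2)]
  have hflow : Tendsto (flow μ γ (x τ₀)) atTop (𝓝 FL₁) :=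
    hS.prodMk_nhds ((tendsto_X₁_of_lapse hμ hm hl).prodMk_nhds
      ((hsq X₂ X₂_sq_le).prodMk_nhds (tendsto_T_of_lapse hm hl)))
  exact (hflow.comp (tendsto_atTop_add_const_right _ (-τ₀) tendsto_id)).congr'
    hx.eventuallyEq_flow

/-! ### Dust in cosmic time -/

/-- The function `√(1 + u² + v² + b² v⁴ / μ⁴)`, the Hubble variable divided by `b`. -/
noncomputable def hubbleFactor (μ u v b : ℝ) : ℝ := √(1 + u ^ 2 + v ^ 2 + b ^ 2 * v ^ 4 / μ ^ 4)

/-- The coefficient `G` in the perturbed oscillator `v' = μ p`, `p' = -μ v + b² G`, where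
`p = u + H v / (2 μ)`. -/
noncomputable def perturbation (μ u v b : ℝ) : ℝ :=
  -(v / (2 * μ)) * (1 + 3 / 2 * u ^ 2 + 1 / 2 * v ^ 2 + 3 / 2 * (b ^ 2 * v ^ 4 / μ ^ 4)) -
    2 * v ^ 3 / μ ^ 3

/-- The equations of the case `γ = 1` on the half-line of nonnegative cosmic time `t`, where
`dt = T² dτ`, for `u = Σ_YM / √Ω_m`, `v = X₂ / √Ω_m` and `b = ((1 - T) / T)² √Ω_m`. -/
structure IsCosmicSolution (μ : ℝ) (u v b : ℝ → ℝ) : Prop where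
  hasDerivAt_u : ∀ t, 0 ≤ t → HasDerivAt u (-(μ * v t) -
    1 / 2 * (b t * hubbleFactor μ (u t) (v t) (b t)) * u t - 2 * b t ^ 2 * v t ^ 3 / μ ^ 3) t
  hasDerivAt_v : ∀ t, 0 ≤ t → HasDerivAt v
    (μ * u t + 1 / 2 * (b t * hubbleFactor μ (u t) (v t) (b t)) * v t) t
  hasDerivAt_b : ∀ t, 0 ≤ t → HasDerivAt b
    (-(3 / 2) * (b t * hubbleFactor μ (u t) (v t) (b t)) * b t) t
  b_pos : ∀ t, 0 ≤ t → 0 < b t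

theorem hubbleFactor_sq (μ u v b : ℝ) :
    hubbleFactor μ u v b ^ 2 = 1 + u ^ 2 + v ^ 2 + b ^ 2 * v ^ 4 / μ ^ 4 :=
  Real.sq_sqrt (by positivity)

theorem one_le_hubbleFactor (μ u v b : ℝ) : 1 ≤ hubbleFactor μ u v b :=
  Real.one_le_sqrt.2 (by have : 0 ≤ u ^ 2 + v ^ 2 + b ^ 2 * v ^ 4 / μ ^ 4 := by positivity
                         linarith)

theorem hubbleFactor_pos (μ u v b : ℝ) : 0 < hubbleFactor μ u v b :=
  one_pos.trans_le (one_le_hubbleFactor μ u v b)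

/-- The constant of the estimate `|b² G| ≤ K H² |v|` for the perturbation `b² G`. -/
noncomputable def driftConst (μ : ℝ) : ℝ := 3 / (4 * μ) + 2 / μ ^ 3

theorem driftConst_pos (hμ : 0 < μ) : 0 < driftConst μ := by unfold driftConst; positivity

theorem abs_sq_mul_perturbation_le (hμ : 0 < μ) (u v b : ℝ) :
    |b ^ 2 * perturbation μ u v b| ≤ driftConst μ * (b * hubbleFactor μ u v b) ^ 2 * |v| := by
  have h1 : b ^ 2 * perturbation μ u v b = -(v * (b ^ 2 * (1 + 3 / 2 * u ^ 2 + 1 / 2 * v ^ 2 +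
      3 / 2 * (b ^ 2 * v ^ 4 / μ ^ 4)) / (2 * μ) + 2 * (b ^ 2 * v ^ 2) / μ ^ 3)) := by
    unfold perturbation; ring
  have hq : 0 ≤ b ^ 2 * v ^ 4 / μ ^ 4 := by positivity
  have hq' : 0 ≤ b ^ 2 * (b ^ 2 * v ^ 4 / μ ^ 4) := by positivity
  have hu := mul_nonneg (sq_nonneg b) (sq_nonneg u)
  have hv := mul_nonneg (sq_nonneg b) (sq_nonneg v)
  rw [h1, abs_neg, abs_mul, mul_comm |v|, abs_of_nonneg (a := _ + _) (by positivity)]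
  refine mul_le_mul_of_nonneg_right ?_ (abs_nonneg v)
  rw [mul_pow, hubbleFactor_sq, driftConst, add_mul]
  refine add_le_add ?_ ?_
  · have h2 : 3 / (4 * μ) * (b ^ 2 * (1 + u ^ 2 + v ^ 2 + b ^ 2 * v ^ 4 / μ ^ 4)) =
        3 / 2 * (b ^ 2 * (1 + u ^ 2 + v ^ 2 + b ^ 2 * v ^ 4 / μ ^ 4)) / (2 * μ) := by
      field_simp; ring
    rw [h2]
    refine div_le_div_of_nonneg_right ?_ (by positivity)
    linarith [sq_nonneg b]
  · rw [div_mul_eq_mul_div]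
    refine div_le_div_of_nonneg_right ?_ (by positivity)
    linarith [sq_nonneg b]

namespace IsCosmicSolution

variable {u v b : ℝ → ℝ}

/-- The variable `p = u + H v / (2 μ)`, for which `v' = μ p` holds exactly. -/
noncomputable def momentum (μ : ℝ) (u v b : ℝ → ℝ) (t : ℝ) : ℝ :=
  u t + b t * hubbleFactor μ (u t) (v t) (b t) * v t / (2 * μ)

/-- The Hubble variable `H`. -/
noncomputable def hubble (μ : ℝ) (u v b : ℝ → ℝ) (t : ℝ) : ℝ :=
  b t * hubbleFactor μ (u t) (v t) (b t)

/-- The complex amplitude: `p + i v`, in the frame that rotates with the frequency `μ`. -/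
noncomputable def amplitude (μ : ℝ) (u v b : ℝ → ℝ) (t : ℝ) : ℂ :=
  Complex.exp (-(Complex.I * (μ * t : ℝ))) * (momentum μ u v b t + v t * Complex.I)

theorem normSq_amplitude (t : ℝ) :
    ‖amplitude μ u v b t‖ ^ 2 = momentum μ u v b t ^ 2 + v t ^ 2 := by
  have h : -(Complex.I * (μ * t : ℝ)) = ((-(μ * t) : ℝ) : ℂ) * Complex.I := by push_cast; ring
  rw [amplitude, norm_mul, h, Complex.norm_exp_ofReal_mul_I, one_mul, ← Complex.normSq_eq_norm_sq,
    Complex.normSq_add_mul_I]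

theorem hubble_pos (h : IsCosmicSolution μ u v b) {t : ℝ} (ht : 0 ≤ t) : 0 < hubble μ u v b t :=
  mul_pos (h.b_pos t ht) (hubbleFactor_pos _ _ _ _)

theorem hasDerivAt_hubble (h : IsCosmicSolution μ u v b) (hμ : 0 < μ) {t : ℝ} (ht : 0 ≤ t) :
    HasDerivAt (hubble μ u v b) (-(3 / 2) * hubble μ u v b t ^ 2 +
      1 / 2 * b t ^ 2 * (v t ^ 2 - u t ^ 2 - b t ^ 2 * v t ^ 4 / μ ^ 4)) t := by
  have hu := h.hasDerivAt_u t ht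
  have hv := h.hasDerivAt_v t ht
  have hb := h.hasDerivAt_b t ht
  have hpos := hubbleFactor_pos μ (u t) (v t) (b t)
  have hF : HasDerivAt (fun t => hubbleFactor μ (u t) (v t) (b t)) _ t :=
    ((((hu.pow 2).const_add 1).add (hv.pow 2)).add (((hb.pow 2).mul (hv.pow 4)).div_const
      (μ ^ 4))).sqrt (by simp only [Pi.add_apply, Pi.pow_apply, Pi.mul_apply]; positivity)
  refine (hb.mul hF).congr_deriv ?_
  simp only [Pi.add_apply, Pi.pow_apply, Pi.mul_apply, hubble]
  rw [← hubbleFactor]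
  generalize hubbleFactor μ (u t) (v t) (b t) = F at *
  generalize u t = u at *
  generalize v t = v at *
  generalize b t = b at *
  push_cast
  field_simp
  ring

theorem hubble_sq (t : ℝ) : hubble μ u v b t ^ 2 =
    b t ^ 2 * (1 + u t ^ 2 + v t ^ 2 + b t ^ 2 * v t ^ 4 / μ ^ 4) := by
  rw [hubble, mul_pow, hubbleFactor_sq]

theorem deriv_hubble_le (t : ℝ) : -(3 / 2) * hubble μ u v b t ^ 2 +
    1 / 2 * b t ^ 2 * (v t ^ 2 - u t ^ 2 - b t ^ 2 * v t ^ 4 / μ ^ 4) ≤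
      -hubble μ u v b t ^ 2 := by
  have h1 : 0 ≤ b t ^ 2 * (b t ^ 2 * v t ^ 4 / μ ^ 4) := by positivity
  have h2 := mul_nonneg (sq_nonneg (b t)) (sq_nonneg (u t))
  rw [hubble_sq]
  linarith [sq_nonneg (b t)]

theorem hasDerivAt_v' (h : IsCosmicSolution μ u v b) (hμ : 0 < μ) {t : ℝ} (ht : 0 ≤ t) :
    HasDerivAt v (μ * momentum μ u v b t) t := by
  refine (h.hasDerivAt_v t ht).congr_deriv ?_
  unfold momentum
  field_simp

theorem hasDerivAt_momentum (h : IsCosmicSolution μ u v b) (hμ : 0 < μ) {t : ℝ} (ht : 0 ≤ t) :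
    HasDerivAt (momentum μ u v b)
      (-(μ * v t) + b t ^ 2 * perturbation μ (u t) (v t) (b t)) t := by
  refine ((h.hasDerivAt_u t ht).add (((h.hasDerivAt_hubble hμ ht).mul
    (h.hasDerivAt_v t ht)).div_const (2 * μ))).congr_deriv ?_
  have hsq := hubble_sq (μ := μ) (u := u) (v := v) (b := b) t
  rw [show b t * hubbleFactor μ (u t) (v t) (b t) = hubble μ u v b t from rfl]
  unfold perturbation
  generalize hubble μ u v b t = H at *
  field_simp
  field_simp at hsq
  linear_combination (-2 * v t) * hsq

theorem hasDerivAt_amplitude (h : IsCosmicSolution μ u v b) (hμ : 0 < μ) {t : ℝ} (ht : 0 ≤ t) :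
    HasDerivAt (amplitude μ u v b) (Complex.exp (-(Complex.I * (μ * t : ℝ))) *
      (b t ^ 2 * perturbation μ (u t) (v t) (b t) : ℝ)) t := by
  have h1 : HasDerivAt (fun t : ℝ => Complex.exp (-(Complex.I * (μ * t : ℝ))))
      (Complex.exp (-(Complex.I * (μ * t : ℝ))) * (-(Complex.I * (μ * 1 : ℝ)))) t :=
    ((((hasDerivAt_id t).const_mul μ).ofReal_comp).const_mul Complex.I).neg.cexp
  have h2 := (h.hasDerivAt_momentum hμ ht).ofReal_comp.add
    ((h.hasDerivAt_v' hμ ht).ofReal_comp.mul_const Complex.I)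
  refine (h1.mul h2).congr_deriv ?_
  simp only [Pi.add_apply]
  push_cast
  ring_nf
  rw [Complex.I_sq]
  ring

theorem norm_deriv_amplitude (t r : ℝ) :
    ‖Complex.exp (-(Complex.I * (μ * t : ℝ))) * (r : ℂ)‖ = |r| := by
  have h : -(Complex.I * (μ * t : ℝ)) = ((-(μ * t) : ℝ) : ℂ) * Complex.I := by push_cast; ring
  rw [norm_mul, h, Complex.norm_exp_ofReal_mul_I, one_mul, Complex.norm_real, Real.norm_eq_abs]

theorem hasDerivAt_normSq_mul_exp (h : IsCosmicSolution μ u v b) (hμ : 0 < μ) (c : ℝ) {t : ℝ}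
    (ht : 0 ≤ t) :
    HasDerivAt (fun t => (momentum μ u v b t ^ 2 + v t ^ 2) * Real.exp (c * hubble μ u v b t))
      ((2 * momentum μ u v b t * (b t ^ 2 * perturbation μ (u t) (v t) (b t)) +
        (momentum μ u v b t ^ 2 + v t ^ 2) * (c * (-(3 / 2) * hubble μ u v b t ^ 2 +
      1 / 2 * b t ^ 2 * (v t ^ 2 - u t ^ 2 - b t ^ 2 * v t ^ 4 / μ ^ 4)))) *
        Real.exp (c * hubble μ u v b t)) t := by
  refine ((((h.hasDerivAt_momentum hμ ht).pow 2).add ((h.hasDerivAt_v' hμ ht).pow 2)).mul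
    ((h.hasDerivAt_hubble hμ ht).const_mul c).exp).congr_deriv ?_
  simp only [Pi.add_apply, Pi.pow_apply]
  push_cast
  ring

theorem abs_two_mul_momentum_mul_le (hμ : 0 < μ) (t : ℝ) :
    |2 * momentum μ u v b t * (b t ^ 2 * perturbation μ (u t) (v t) (b t))| ≤
      (momentum μ u v b t ^ 2 + v t ^ 2) * (driftConst μ * hubble μ u v b t ^ 2) := by
  have h1 := abs_sq_mul_perturbation_le hμ (u t) (v t) (b t)
  rw [abs_mul, abs_mul, abs_two]
  have hK : 0 ≤ driftConst μ * hubble μ u v b t ^ 2 :=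
    mul_nonneg (driftConst_pos hμ).le (sq_nonneg _)
  calc 2 * |momentum μ u v b t| * |b t ^ 2 * perturbation μ (u t) (v t) (b t)|
      ≤ 2 * |momentum μ u v b t| * (driftConst μ * hubble μ u v b t ^ 2 * |v t|) := by
        gcongr; exact h1
    _ = 2 * |momentum μ u v b t| * |v t| * (driftConst μ * hubble μ u v b t ^ 2) := by ring
    _ ≤ (|momentum μ u v b t| ^ 2 + |v t| ^ 2) * (driftConst μ * hubble μ u v b t ^ 2) :=
        mul_le_mul_of_nonneg_right (two_mul_le_add_sq _ _) hK
    _ = _ := by rw [sq_abs, sq_abs]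

/-- The drift of the logarithm of `p² + v²` is bounded by `-K H'`, because `|b² G| ≤ K H² |v|` and
`H' ≤ -H²`. -/
theorem antitoneOn_normSq_mul_exp (h : IsCosmicSolution μ u v b) (hμ : 0 < μ) :
    AntitoneOn (fun t => (momentum μ u v b t ^ 2 + v t ^ 2) *
      Real.exp (driftConst μ * hubble μ u v b t)) (Ici 0) := by
  have hd := fun t (ht : t ∈ Ici (0 : ℝ)) => h.hasDerivAt_normSq_mul_exp hμ (driftConst μ) ht
  refine antitoneOn_of_hasDerivWithinAt_nonpos (convex_Ici _)
    (fun t ht => (hd t ht).continuousAt.continuousWithinAt)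
    (fun t ht => (hd t (interior_subset ht)).hasDerivWithinAt) fun t ht => ?_
  refine mul_nonpos_of_nonpos_of_nonneg ?_ (Real.exp_pos _).le
  have h1 := (abs_le.1 (abs_two_mul_momentum_mul_le (u := u) (v := v) (b := b) hμ t)).2
  have h2 := mul_le_mul_of_nonneg_left (mul_le_mul_of_nonneg_left
    (deriv_hubble_le (μ := μ) (u := u) (v := v) (b := b) t) (driftConst_pos hμ).le)
    (add_nonneg (sq_nonneg (momentum μ u v b t)) (sq_nonneg (v t)))
  linarith

theorem monotoneOn_normSq_mul_exp (h : IsCosmicSolution μ u v b) (hμ : 0 < μ) :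
    MonotoneOn (fun t => (momentum μ u v b t ^ 2 + v t ^ 2) *
      Real.exp (-driftConst μ * hubble μ u v b t)) (Ici 0) := by
  have hd := fun t (ht : t ∈ Ici (0 : ℝ)) => h.hasDerivAt_normSq_mul_exp hμ (-driftConst μ) ht
  refine monotoneOn_of_hasDerivWithinAt_nonneg (convex_Ici _)
    (fun t ht => (hd t ht).continuousAt.continuousWithinAt)
    (fun t ht => (hd t (interior_subset ht)).hasDerivWithinAt) fun t ht => ?_
  refine mul_nonneg ?_ (Real.exp_pos _).le
  have h1 := (abs_le.1 (abs_two_mul_momentum_mul_le (u := u) (v := v) (b := b) hμ t)).1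
  have h2 := mul_le_mul_of_nonneg_left (mul_le_mul_of_nonneg_left
    (deriv_hubble_le (μ := μ) (u := u) (v := v) (b := b) t) (driftConst_pos hμ).le)
    (add_nonneg (sq_nonneg (momentum μ u v b t)) (sq_nonneg (v t)))
  linarith

theorem antitoneOn_hubble (h : IsCosmicSolution μ u v b) (hμ : 0 < μ) :
    AntitoneOn (hubble μ u v b) (Ici 0) :=
  antitoneOn_of_hasDerivWithinAt_nonpos (convex_Ici _)
    (fun _ ht => (h.hasDerivAt_hubble hμ ht).continuousAt.continuousWithinAt)
    (fun _ ht => (h.hasDerivAt_hubble hμ (interior_subset ht)).hasDerivWithinAt) fun _ _ =>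
    (deriv_hubble_le _).trans (neg_nonpos.2 (sq_nonneg _))

theorem hasDerivAt_inv_b (h : IsCosmicSolution μ u v b) {t : ℝ} (ht : 0 ≤ t) :
    HasDerivAt (fun t => (b t)⁻¹) (3 / 2 * hubbleFactor μ (u t) (v t) (b t)) t := by
  have hb := h.b_pos t ht
  refine ((h.hasDerivAt_b t ht).inv hb.ne').congr_deriv ?_
  field_simp

theorem inv_b_ge (h : IsCosmicSolution μ u v b) {t : ℝ} (ht : 0 ≤ t) :
    (b 0)⁻¹ + 3 / 2 * t ≤ (b t)⁻¹ := by
  have hd := fun t (ht : t ∈ Ici (0 : ℝ)) =>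
    (h.hasDerivAt_inv_b ht).sub ((hasDerivAt_id t).const_mul (3 / 2))
  have : MonotoneOn (fun t => (b t)⁻¹ - 3 / 2 * t) (Ici 0) :=
    monotoneOn_of_hasDerivWithinAt_nonneg (convex_Ici _)
      (fun t ht => (hd t ht).continuousAt.continuousWithinAt)
      (fun t ht => (hd t (interior_subset ht)).hasDerivWithinAt) fun t _ => by
        linarith [one_le_hubbleFactor μ (u t) (v t) (b t)]
  have := this self_mem_Ici ht ht
  simp only [mul_zero, sub_zero] at this
  linarith

theorem tendsto_b (h : IsCosmicSolution μ u v b) : Tendsto b atTop (𝓝 0) := by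
  have h1 : Tendsto (fun t => (b t)⁻¹) atTop atTop := by
    refine tendsto_atTop_mono' _ ?_ (tendsto_atTop_add_const_left _ (b 0)⁻¹
      (tendsto_id.const_mul_atTop (by norm_num : (0 : ℝ) < 3 / 2)))
    filter_upwards [eventually_ge_atTop 0] with t ht using h.inv_b_ge ht
  simpa [Function.comp_def] using tendsto_inv_atTop_zero.comp h1

theorem sq_add_sq_le (h : IsCosmicSolution μ u v b) (hμ : 0 < μ) {t : ℝ} (ht : 0 ≤ t) :
    momentum μ u v b t ^ 2 + v t ^ 2 ≤ (momentum μ u v b 0 ^ 2 + v 0 ^ 2) *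
      Real.exp (driftConst μ * hubble μ u v b 0) := by
  refine le_trans ?_ (h.antitoneOn_normSq_mul_exp hμ self_mem_Ici ht ht)
  exact le_mul_of_one_le_right (by positivity)
    (Real.one_le_exp (mul_nonneg (driftConst_pos hμ).le (h.hubble_pos ht).le))

theorem abs_u_le (h : IsCosmicSolution μ u v b) (hμ : 0 < μ) {t : ℝ} (ht : 0 ≤ t) :
    |u t| ≤ |momentum μ u v b t| + hubble μ u v b 0 * |v t| / (2 * μ) := by
  have h1 : u t = momentum μ u v b t - hubble μ u v b t * v t / (2 * μ) := by
    unfold momentum hubble; ring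
  rw [h1]
  refine (abs_sub _ _).trans (add_le_add le_rfl ?_)
  rw [abs_div, abs_mul, abs_of_pos (h.hubble_pos ht), abs_of_pos (mul_pos two_pos hμ)]
  have := h.antitoneOn_hubble hμ self_mem_Ici ht ht
  gcongr

/-- A bound on all of the future for solutions with initial data in a given disc. -/
theorem exists_bound (hμ : 0 < μ) (R : ℝ) : ∃ R', ∀ u v b : ℝ → ℝ, IsCosmicSolution μ u v b →
    b 0 ≤ 1 → u 0 ^ 2 + v 0 ^ 2 ≤ R ^ 2 → ∀ t, 0 ≤ t → |u t| ≤ R' ∧ |v t| ≤ R' := by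
  obtain ⟨η, hη⟩ : ∃ η, η = √(1 + R ^ 2 + R ^ 4 / μ ^ 4) := ⟨_, rfl⟩
  have hη0 : 0 ≤ η := hη ▸ Real.sqrt_nonneg _
  obtain ⟨P, hP⟩ : ∃ P, P = √(((|R| + η * |R| / (2 * μ)) ^ 2 + R ^ 2) *
    Real.exp (driftConst μ * η)) := ⟨_, rfl⟩
  have hP0 : 0 ≤ P := hP ▸ Real.sqrt_nonneg _
  refine ⟨P + η * P / (2 * μ), fun u v b h hb hR t ht => ?_⟩
  have hb0 := h.b_pos 0 le_rfl
  have hu0 : |u 0| ≤ |R| := sq_le_sq.1 (by linarith [sq_nonneg (v 0)])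
  have hv0 : |v 0| ≤ |R| := sq_le_sq.1 (by linarith [sq_nonneg (u 0)])
  have hH : hubble μ u v b 0 ≤ η := by
    rw [hη]
    refine Real.le_sqrt_of_sq_le ?_
    rw [hubble_sq]
    have hb2 : b 0 ^ 2 ≤ 1 := pow_le_one₀ hb0.le hb
    have hv4 : v 0 ^ 4 ≤ R ^ 4 := by
      have : v 0 ^ 2 ≤ R ^ 2 := by linarith [sq_nonneg (u 0)]
      nlinarith [sq_nonneg (v 0)]
    have h1 : b 0 ^ 2 * v 0 ^ 4 / μ ^ 4 ≤ R ^ 4 / μ ^ 4 := by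
      refine div_le_div_of_nonneg_right ?_ (by positivity)
      exact (mul_le_of_le_one_left (by positivity) hb2).trans hv4
    refine (mul_le_of_le_one_left (by positivity) hb2).trans ?_
    linarith
  have hH0 := (h.hubble_pos le_rfl).le
  have hp0 : |momentum μ u v b 0| ≤ |R| + η * |R| / (2 * μ) := by
    have : momentum μ u v b 0 = u 0 + hubble μ u v b 0 * v 0 / (2 * μ) := rfl
    rw [this]
    refine (abs_add_le _ _).trans (add_le_add hu0 ?_)
    rw [abs_div, abs_mul, abs_of_nonneg hH0, abs_of_pos (mul_pos two_pos hμ)]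
    gcongr
  have hN : momentum μ u v b t ^ 2 + v t ^ 2 ≤ P ^ 2 := by
    refine (h.sq_add_sq_le hμ ht).trans ?_
    rw [hP, Real.sq_sqrt (by positivity)]
    have h1 : momentum μ u v b 0 ^ 2 ≤ (|R| + η * |R| / (2 * μ)) ^ 2 := by
      rw [← sq_abs]; gcongr
    have h2 : v 0 ^ 2 ≤ R ^ 2 := sq_le_sq.2 hv0
    have h3 := driftConst_pos hμ
    gcongr
  have hp : |momentum μ u v b t| ≤ P := abs_le_of_sq_le_sq (by linarith [sq_nonneg (v t)]) hP0
  have hv : |v t| ≤ P := abs_le_of_sq_le_sq (by linarith [sq_nonneg (momentum μ u v b t)]) hP0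
  refine ⟨(h.abs_u_le hμ ht).trans ?_, hv.trans (le_add_of_nonneg_right (by positivity))⟩
  gcongr

/-! ### The asymptotic amplitude -/

theorem tendsto_hubble (h : IsCosmicSolution μ u v b) (hμ : 0 < μ) :
    Tendsto (hubble μ u v b) atTop (𝓝 0) := by
  obtain ⟨R', hR'⟩ : ∃ R', ∀ t, 0 ≤ t → |u t| ≤ R' ∧ |v t| ≤ R' := by
    obtain ⟨P, hP⟩ : ∃ P, P = √((momentum μ u v b 0 ^ 2 + v 0 ^ 2) *
      Real.exp (driftConst μ * hubble μ u v b 0)) := ⟨_, rfl⟩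
    have hP0 : 0 ≤ P := hP ▸ Real.sqrt_nonneg _
    have hH0 := (h.hubble_pos le_rfl).le
    refine ⟨P + hubble μ u v b 0 * P / (2 * μ), fun t ht => ?_⟩
    have hN : momentum μ u v b t ^ 2 + v t ^ 2 ≤ P ^ 2 := by
      rw [hP, Real.sq_sqrt (by positivity)]
      exact h.sq_add_sq_le hμ ht
    have hp : |momentum μ u v b t| ≤ P := abs_le_of_sq_le_sq (by linarith [sq_nonneg (v t)]) hP0
    have hv : |v t| ≤ P := abs_le_of_sq_le_sq (by linarith [sq_nonneg (momentum μ u v b t)]) hP0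
    refine ⟨(h.abs_u_le hμ ht).trans ?_, hv.trans (le_add_of_nonneg_right (by positivity))⟩
    gcongr
  have hR0 : 0 ≤ R' := (abs_nonneg _).trans (hR' 0 le_rfl).1
  have hlim : Tendsto (fun t => √(b t ^ 2 * (1 + R' ^ 2 + R' ^ 2 + b t ^ 2 * R' ^ 4 / μ ^ 4)))
      atTop (𝓝 0) := by
    have hb := h.tendsto_b
    have := ((hb.pow 2).mul ((((hb.pow 2).mul_const (R' ^ 4)).div_const (μ ^ 4)).const_add
      (1 + R' ^ 2 + R' ^ 2))).sqrt
    simpa using this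
  refine squeeze_zero' ?_ ?_ hlim
  · filter_upwards [eventually_ge_atTop 0] with t ht using (h.hubble_pos ht).le
  · filter_upwards [eventually_ge_atTop 0] with t ht
    refine Real.le_sqrt_of_sq_le ?_
    rw [hubble_sq]
    have h1 : u t ^ 2 ≤ R' ^ 2 := sq_le_sq.2 ((hR' t ht).1.trans (le_abs_self _))
    have h2 : v t ^ 2 ≤ R' ^ 2 := sq_le_sq.2 ((hR' t ht).2.trans (le_abs_self _))
    have h3 : v t ^ 4 ≤ R' ^ 4 := by nlinarith [sq_nonneg (v t)]
    gcongr

theorem continuousOn_amplitude (h : IsCosmicSolution μ u v b) (hμ : 0 < μ) :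
    ContinuousOn (amplitude μ u v b) (Ici 0) := fun _ ht =>
  (h.hasDerivAt_amplitude hμ ht).continuousAt.continuousWithinAt

/-- The rotating amplitude has a limit, since its derivative is bounded by a multiple of `-H'`. -/
theorem exists_tendsto_amplitude (h : IsCosmicSolution μ u v b) (hμ : 0 < μ) :
    ∃ ζ, Tendsto (amplitude μ u v b) atTop (𝓝 ζ) := by
  obtain ⟨P, hP⟩ : ∃ P, P = √((momentum μ u v b 0 ^ 2 + v 0 ^ 2) *
    Real.exp (driftConst μ * hubble μ u v b 0)) := ⟨_, rfl⟩
  have hP0 : 0 ≤ P := hP ▸ Real.sqrt_nonneg _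
  have hv : ∀ t, 0 ≤ t → |v t| ≤ P := fun t ht => by
    refine abs_le_of_sq_le_sq ?_ hP0
    rw [hP, Real.sq_sqrt (by positivity)]
    linarith [h.sq_add_sq_le hμ ht, sq_nonneg (momentum μ u v b t)]
  have hK := driftConst_pos hμ
  have hest : ∀ s t, 0 ≤ s → s ≤ t → ‖amplitude μ u v b t - amplitude μ u v b s‖ ≤
      driftConst μ * P * hubble μ u v b s := fun s t hs hst => by
    have hH := (h.hubble_pos (hs.trans hst)).le
    have := image_norm_le_of_norm_deriv_right_le_deriv_boundary' (a := s) (b := t)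
      (f := fun t => amplitude μ u v b t - amplitude μ u v b s)
      (B := fun t => driftConst μ * P * (hubble μ u v b s - hubble μ u v b t))
      (((h.continuousOn_amplitude hμ).mono
        (Icc_subset_Ici_self.trans (Ici_subset_Ici.2 hs))).sub continuousOn_const)
      (fun r hr => ((h.hasDerivAt_amplitude hμ (hs.trans hr.1)).sub_const _).hasDerivWithinAt)
      (by simp)
      (fun r hr => ((((h.hasDerivAt_hubble hμ (hs.trans hr.1)).const_sub
        (hubble μ u v b s)).const_mul (driftConst μ * P))).continuousAt.continuousWithinAt)
      (fun r hr => ((((h.hasDerivAt_hubble hμ (hs.trans hr.1)).const_sub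
        (hubble μ u v b s)).const_mul (driftConst μ * P))).hasDerivWithinAt)
      (fun r hr => ?_) (⟨hst, le_rfl⟩ : t ∈ Icc s t)
    · refine this.trans ?_
      have := mul_nonneg (mul_nonneg hK.le hP0) hH
      linarith
    · rw [norm_deriv_amplitude]
      refine (abs_sq_mul_perturbation_le hμ _ _ _).trans ?_
      rw [mul_assoc, mul_assoc]
      refine mul_le_mul_of_nonneg_left ?_ hK.le
      rw [mul_comm]
      refine mul_le_mul (hv r (hs.trans hr.1)) ?_ (sq_nonneg _) hP0
      have := deriv_hubble_le (μ := μ) (u := u) (v := v) (b := b) r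
      change hubble μ u v b r ^ 2 ≤ _
      linarith
  have hlim : Tendsto (fun t => 2 * (driftConst μ * P * hubble μ u v b (max 0 t))) atTop
      (𝓝 0) := by
    have h1 : Tendsto (fun t : ℝ => max 0 t) atTop atTop :=
      tendsto_atTop_mono (fun t => le_max_right 0 t) tendsto_id
    simpa using (((h.tendsto_hubble hμ).comp h1).const_mul (driftConst μ * P)).const_mul 2
  have hc : CauchySeq fun t => amplitude μ u v b (max 0 t) := by
    refine cauchySeq_of_le_tendsto_0 _ (fun n m N hn hm => ?_) hlim
    have h1 := hest (max 0 N) (max 0 n) (le_max_left _ _) (max_le_max le_rfl hn)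
    have h2 := hest (max 0 N) (max 0 m) (le_max_left _ _) (max_le_max le_rfl hm)
    rw [← dist_eq_norm] at h1 h2
    refine (dist_triangle_right _ _ (amplitude μ u v b (max 0 N))).trans ?_
    linarith
  obtain ⟨ζ, hζ⟩ := cauchySeq_tendsto_of_complete hc
  refine ⟨ζ, hζ.congr' ?_⟩
  filter_upwards [eventually_ge_atTop 0] with t ht
  rw [max_eq_right ht]

theorem normSq_le_of_tendsto (h : IsCosmicSolution μ u v b) (hμ : 0 < μ) {ζ : ℂ}
    (hζ : Tendsto (amplitude μ u v b) atTop (𝓝 ζ)) {t : ℝ} (ht : 0 ≤ t) :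
    momentum μ u v b t ^ 2 + v t ^ 2 ≤ ‖ζ‖ ^ 2 * Real.exp (driftConst μ * hubble μ u v b t) := by
  have h1 : Tendsto (fun t => (momentum μ u v b t ^ 2 + v t ^ 2) *
      Real.exp (-driftConst μ * hubble μ u v b t)) atTop (𝓝 (‖ζ‖ ^ 2)) := by
    have := (hζ.norm.pow 2).mul (((h.tendsto_hubble hμ).const_mul (-driftConst μ)).rexp)
    simpa only [normSq_amplitude, mul_zero, Real.exp_zero, mul_one] using this
  have h2 : (momentum μ u v b t ^ 2 + v t ^ 2) *
      Real.exp (-driftConst μ * hubble μ u v b t) ≤ ‖ζ‖ ^ 2 := by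
    refine ge_of_tendsto h1 ?_
    filter_upwards [eventually_ge_atTop t] with s hs
    exact h.monotoneOn_normSq_mul_exp hμ ht (ht.trans hs) hs
  rw [neg_mul, Real.exp_neg, ← div_eq_mul_inv, div_le_iff₀ (Real.exp_pos _)] at h2
  exact h2

theorem norm_limit_le (h : IsCosmicSolution μ u v b) (hμ : 0 < μ) {ζ : ℂ}
    (hζ : Tendsto (amplitude μ u v b) atTop (𝓝 ζ)) :
    ‖ζ‖ ^ 2 ≤ (momentum μ u v b 0 ^ 2 + v 0 ^ 2) *
      Real.exp (driftConst μ * hubble μ u v b 0) := by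
  have h1 : Tendsto (fun t => (momentum μ u v b t ^ 2 + v t ^ 2)) atTop (𝓝 (‖ζ‖ ^ 2)) := by
    simpa only [normSq_amplitude] using hζ.norm.pow 2
  refine le_of_tendsto h1 ?_
  filter_upwards [eventually_ge_atTop 0] with t ht using h.sq_add_sq_le hμ ht

/-- The square of the limit amplitude is the limit of `Ω_YM / Ω_m`. -/
theorem tendsto_energy (h : IsCosmicSolution μ u v b) (hμ : 0 < μ) {ζ : ℂ}
    (hζ : Tendsto (amplitude μ u v b) atTop (𝓝 ζ)) :
    Tendsto (fun t => hubbleFactor μ (u t) (v t) (b t) ^ 2 - 1) atTop (𝓝 (‖ζ‖ ^ 2)) := by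
  obtain ⟨P, hP⟩ : ∃ P, P = √((momentum μ u v b 0 ^ 2 + v 0 ^ 2) *
    Real.exp (driftConst μ * hubble μ u v b 0)) := ⟨_, rfl⟩
  have hP0 : 0 ≤ P := hP ▸ Real.sqrt_nonneg _
  have hN : ∀ t, 0 ≤ t → momentum μ u v b t ^ 2 + v t ^ 2 ≤ P ^ 2 := fun t ht => by
    rw [hP, Real.sq_sqrt (by positivity)]
    exact h.sq_add_sq_le hμ ht
  have hpv : ∀ t, 0 ≤ t → |momentum μ u v b t| ≤ P ∧ |v t| ≤ P := fun t ht =>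
    ⟨abs_le_of_sq_le_sq (by linarith [sq_nonneg (v t), hN t ht]) hP0,
      abs_le_of_sq_le_sq (by linarith [sq_nonneg (momentum μ u v b t), hN t ht]) hP0⟩
  have h1 : Tendsto (fun t => momentum μ u v b t ^ 2 + v t ^ 2) atTop (𝓝 (‖ζ‖ ^ 2)) := by
    simpa only [normSq_amplitude] using hζ.norm.pow 2
  have hH := h.tendsto_hubble hμ
  have hb := h.tendsto_b
  have hlim : Tendsto (fun t => hubble μ u v b t * (P * P / μ) +
      hubble μ u v b t ^ 2 * (P ^ 2 / (4 * μ ^ 2)) + b t ^ 2 * (P ^ 4 / μ ^ 4)) atTop (𝓝 0) := by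
    have := ((hH.mul_const (P * P / μ)).add ((hH.pow 2).mul_const (P ^ 2 / (4 * μ ^ 2)))).add
      ((hb.pow 2).mul_const (P ^ 4 / μ ^ 4))
    simpa using this
  have h2 : Tendsto (fun t => (hubbleFactor μ (u t) (v t) (b t) ^ 2 - 1) -
      (momentum μ u v b t ^ 2 + v t ^ 2)) atTop (𝓝 0) := by
    refine squeeze_zero_norm' ?_ hlim
    filter_upwards [eventually_ge_atTop 0] with t ht
    have hu : u t = momentum μ u v b t - hubble μ u v b t * v t / (2 * μ) := by
      unfold momentum hubble; ring
    have hHt := (h.hubble_pos ht).le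
    obtain ⟨hp, hv⟩ := hpv t ht
    have e : hubbleFactor μ (u t) (v t) (b t) ^ 2 - 1 - (momentum μ u v b t ^ 2 + v t ^ 2) =
        -(hubble μ u v b t * (momentum μ u v b t * v t / μ)) +
        hubble μ u v b t ^ 2 * (v t ^ 2 / (4 * μ ^ 2)) + b t ^ 2 * (v t ^ 4 / μ ^ 4) := by
      rw [hubbleFactor_sq]
      nth_rw 1 [hu]
      field_simp
      ring
    have hv2 : v t ^ 2 ≤ P ^ 2 := sq_le_sq.2 (hv.trans (le_abs_self _))
    have hv4 : v t ^ 4 ≤ P ^ 4 := by nlinarith [sq_nonneg (v t)]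
    rw [e, Real.norm_eq_abs]
    refine (abs_add_le _ _).trans (add_le_add ((abs_add_le _ _).trans (add_le_add ?_ ?_)) ?_)
    · rw [abs_neg, abs_mul, abs_of_nonneg hHt, abs_div, abs_mul, abs_of_pos hμ]
      gcongr
    · rw [abs_of_nonneg (by positivity)]
      gcongr
    · rw [abs_of_nonneg (by positivity)]
      gcongr
  simpa using h2.add h1

end IsCosmicSolution

/-! ### Comparison of two solutions -/

/-- A function of class `C¹` on `ℝ³` is bounded and Lipschitz on boxes. -/
theorem exists_bound_lipschitz_of_contDiff {f : ℝ × ℝ × ℝ → ℝ} (hf : ContDiff ℝ 1 f) (R : ℝ) :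
    ∃ L, ∀ u₁ v₁ b₁ u₂ v₂ b₂ m d : ℝ, |u₁| ≤ R → |v₁| ≤ R → |b₁| ≤ 1 → |u₂| ≤ R → |v₂| ≤ R →
      |b₂| ≤ 1 → |u₁ - u₂| ≤ m → |v₁ - v₂| ≤ m → |b₁ - b₂| ≤ d →
      |f (u₁, v₁, b₁) - f (u₂, v₂, b₂)| ≤ L * (m + d) ∧ |f (u₁, v₁, b₁)| ≤ L := by
  obtain ⟨ρ, hρ⟩ : ∃ ρ, ρ = max R 1 := ⟨_, rfl⟩
  have hcomp : IsCompact (Metric.closedBall (0 : ℝ × ℝ × ℝ) ρ) := isCompact_closedBall _ _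
  obtain ⟨K, hK⟩ := hf.locallyLipschitz.locallyLipschitzOn.exists_lipschitzOnWith_of_compact hcomp
  obtain ⟨C, hC⟩ := hcomp.exists_bound_of_continuousOn hf.continuous.continuousOn
  have hmem : ∀ u v b : ℝ, |u| ≤ R → |v| ≤ R → |b| ≤ 1 →
      (u, v, b) ∈ Metric.closedBall (0 : ℝ × ℝ × ℝ) ρ := fun u v b hu hv hb => by
    rw [mem_closedBall_zero_iff, hρ]
    simp only [Prod.norm_def, Real.norm_eq_abs]
    exact max_le (hu.trans (le_max_left _ _)) (max_le (hv.trans (le_max_left _ _))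
      (hb.trans (le_max_right _ _)))
  refine ⟨max K C, fun u₁ v₁ b₁ u₂ v₂ b₂ m d h1 h2 h3 h4 h5 h6 h7 h8 h9 => ⟨?_, ?_⟩⟩
  · have := hK.dist_le_mul _ (hmem _ _ _ h1 h2 h3) _ (hmem _ _ _ h4 h5 h6)
    rw [Real.dist_eq] at this
    have hm : 0 ≤ m := (abs_nonneg _).trans h7
    have hd : 0 ≤ d := (abs_nonneg _).trans h9
    refine this.trans (mul_le_mul (le_max_left _ _) ?_ dist_nonneg
      (K.coe_nonneg.trans (le_max_left _ _)))
    simp only [Prod.dist_eq, Real.dist_eq]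
    exact max_le (by linarith) (max_le (by linarith) (by linarith))
  · exact (hC _ (hmem _ _ _ h1 h2 h3)).trans (le_max_right _ _)

theorem contDiff_hubbleFactor (μ : ℝ) :
    ContDiff ℝ 1 fun x : ℝ × ℝ × ℝ => hubbleFactor μ x.1 x.2.1 x.2.2 := by
  unfold hubbleFactor
  refine ContDiff.sqrt (by fun_prop) fun x => ?_
  positivity

namespace IsCosmicSolution

variable {u₁ v₁ b₁ u₂ v₂ b₂ : ℝ → ℝ}

/-- Two solutions with the same initial value `β` of `b`, which stay in a box where
`F = hubbleFactor`, `F v` and `G = perturbation` have the Lipschitz constant `L`, and `F v` and `G`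
the bound `L`. If `β` is small, then the difference of the amplitudes stays close to the initial
difference of `u + i v`. The differences of `u + i v` and of `1 / b`, the latter relative to
`1 / β + 3 t / 2`, are estimated in terms of each other. -/
theorem norm_amplitude_sub_le (hμ : 0 < μ) (h₁ : IsCosmicSolution μ u₁ v₁ b₁)
    (h₂ : IsCosmicSolution μ u₂ v₂ b₂) {β L R : ℝ} (hβ1 : β ≤ 1)
    (hβL : β * L ≤ 1 / 2) (hβL' : β * (L * (2 / μ + 2) * (1 + 2 * L)) ≤ 1 / 3)
    (hb₁ : b₁ 0 = β) (hb₂ : b₂ 0 = β) (hR₁ : ∀ t, 0 ≤ t → |u₁ t| ≤ R ∧ |v₁ t| ≤ R)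
    (hR₂ : ∀ t, 0 ≤ t → |u₂ t| ≤ R ∧ |v₂ t| ≤ R)
    (hF : ∀ u₁ v₁ b₁ u₂ v₂ b₂ m d : ℝ, |u₁| ≤ R → |v₁| ≤ R → |b₁| ≤ 1 → |u₂| ≤ R → |v₂| ≤ R →
      |b₂| ≤ 1 → |u₁ - u₂| ≤ m → |v₁ - v₂| ≤ m → |b₁ - b₂| ≤ d →
      |hubbleFactor μ u₁ v₁ b₁ - hubbleFactor μ u₂ v₂ b₂| ≤ L * (m + d) ∧
      |hubbleFactor μ u₁ v₁ b₁ * v₁ - hubbleFactor μ u₂ v₂ b₂ * v₂| ≤ L * (m + d) ∧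
      |perturbation μ u₁ v₁ b₁ - perturbation μ u₂ v₂ b₂| ≤ L * (m + d) ∧
      |hubbleFactor μ u₁ v₁ b₁ * v₁| ≤ L ∧ |perturbation μ u₁ v₁ b₁| ≤ L)
    {t : ℝ} (ht : 0 ≤ t) :
    ‖(amplitude μ u₁ v₁ b₁ t - amplitude μ u₂ v₂ b₂ t) -
      ((u₁ 0 + v₁ 0 * Complex.I) - (u₂ 0 + v₂ 0 * Complex.I))‖ ≤
      1 / 2 * ‖((u₁ 0 + v₁ 0 * Complex.I) - (u₂ 0 + v₂ 0 * Complex.I) : ℂ)‖ := by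
  have hβ : 0 < β := hb₁ ▸ h₁.b_pos 0 le_rfl
  let U : ℝ → ℂ := fun t => (u₁ t + v₁ t * Complex.I) - (u₂ t + v₂ t * Complex.I)
  let W : ℝ → ℂ := fun t => (momentum μ u₁ v₁ b₁ t + v₁ t * Complex.I) -
    (momentum μ u₂ v₂ b₂ t + v₂ t * Complex.I)
  let Z : ℝ → ℂ := fun t => amplitude μ u₁ v₁ b₁ t - amplitude μ u₂ v₂ b₂ t
  -- A common lower bound for `1 / b₁` and `1 / b₂`, as `(1 / b)' = 3 F / 2` with `F ≥ 1`.
  let ℓ : ℝ → ℝ := fun t => β⁻¹ + 3 / 2 * t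
  let Y : ℝ → ℝ := fun t => (b₁ t)⁻¹ - (b₂ t)⁻¹
  have hℓ0 : ∀ s, 0 ≤ s → 0 < ℓ s := fun s hs => by
    have := inv_pos.2 hβ
    simp only [ℓ]; positivity
  have hℓβ : ∀ s, 0 ≤ s → (ℓ s)⁻¹ ≤ β := fun s hs => by
    rw [inv_le_comm₀ (hℓ0 s hs) hβ]
    simp only [ℓ]; linarith
  have hbℓ₁ : ∀ s, 0 ≤ s → b₁ s ≤ (ℓ s)⁻¹ := fun s hs => by
    rw [le_inv_comm₀ (h₁.b_pos s hs) (hℓ0 s hs)]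
    simpa [ℓ, hb₁] using h₁.inv_b_ge hs
  have hbℓ₂ : ∀ s, 0 ≤ s → b₂ s ≤ (ℓ s)⁻¹ := fun s hs => by
    rw [le_inv_comm₀ (h₂.b_pos s hs) (hℓ0 s hs)]
    simpa [ℓ, hb₂] using h₂.inv_b_ge hs
  have hUc : ContinuousOn U (Icc 0 t) := fun s hs => by
    have a1 := (h₁.hasDerivAt_u s hs.1).ofReal_comp.continuousAt
    have a2 := (h₁.hasDerivAt_v s hs.1).ofReal_comp.continuousAt
    have a3 := (h₂.hasDerivAt_u s hs.1).ofReal_comp.continuousAt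
    have a4 := (h₂.hasDerivAt_v s hs.1).ofReal_comp.continuousAt
    exact ((a1.add (a2.mul continuousAt_const)).sub
      (a3.add (a4.mul continuousAt_const))).continuousWithinAt
  have hYd : ∀ s, 0 ≤ s → HasDerivAt Y (3 / 2 * hubbleFactor μ (u₁ s) (v₁ s) (b₁ s) -
      3 / 2 * hubbleFactor μ (u₂ s) (v₂ s) (b₂ s)) s := fun s hs =>
    (h₁.hasDerivAt_inv_b hs).sub (h₂.hasDerivAt_inv_b hs)
  have hYc : ContinuousOn (fun s => |Y s| / ℓ s) (Icc 0 t) := fun s hs => by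
    have : ContinuousAt ℓ s := by simp only [ℓ]; fun_prop
    exact ((hYd s hs.1).continuousAt.abs.div this (hℓ0 s hs.1).ne').continuousWithinAt
  have hne : (Icc 0 t).Nonempty := ⟨0, le_rfl, ht⟩
  obtain ⟨tm, htm, hmaxm⟩ := isCompact_Icc.exists_isMaxOn hne hUc.norm
  obtain ⟨tj, htj, hmaxj⟩ := isCompact_Icc.exists_isMaxOn hne hYc
  obtain ⟨m, hm⟩ : ∃ m, m = ‖U tm‖ := ⟨_, rfl⟩
  obtain ⟨j, hj⟩ : ∃ j, j = |Y tj| / ℓ tj := ⟨_, rfl⟩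
  have hm0 : 0 ≤ m := hm ▸ norm_nonneg _
  have hj0 : 0 ≤ j := hj ▸ div_nonneg (abs_nonneg _) (hℓ0 _ htj.1).le
  have hUm : ∀ s ∈ Icc 0 t, ‖U s‖ ≤ m := fun s hs => hm ▸ hmaxm hs
  have hYj : ∀ s ∈ Icc 0 t, |Y s| ≤ j * ℓ s := fun s hs => by
    have : |Y s| / ℓ s ≤ j := hj ▸ hmaxj hs
    rwa [div_le_iff₀ (hℓ0 s hs.1)] at this
  have hu : ∀ s ∈ Icc 0 t, |u₁ s - u₂ s| ≤ m := fun s hs => by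
    have := (Complex.abs_re_le_norm (U s)).trans (hUm s hs)
    simpa [U] using this
  have hv : ∀ s ∈ Icc 0 t, |v₁ s - v₂ s| ≤ m := fun s hs => by
    have := (Complex.abs_im_le_norm (U s)).trans (hUm s hs)
    simpa [U] using this
  have hb : ∀ s ∈ Icc 0 t, |b₁ s - b₂ s| ≤ j * (ℓ s)⁻¹ := fun s hs => by
    have p1 := h₁.b_pos s hs.1
    have p2 := h₂.b_pos s hs.1
    have e : b₁ s - b₂ s = -(Y s * (b₁ s * b₂ s)) := by
      simp only [Y]; field_simp; ring
    have hl := hℓ0 s hs.1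
    rw [e, abs_neg, abs_mul, abs_of_pos (mul_pos p1 p2)]
    calc |Y s| * (b₁ s * b₂ s) ≤ (j * ℓ s) * ((ℓ s)⁻¹ * (ℓ s)⁻¹) := by
          have := hYj s hs
          have := hbℓ₁ s hs.1
          have := hbℓ₂ s hs.1
          gcongr
      _ = j * (ℓ s)⁻¹ := by field_simp
  have hb1 : ∀ s ∈ Icc 0 t, |b₁ s| ≤ 1 ∧ |b₂ s| ≤ 1 := fun s hs => by
    rw [abs_of_pos (h₁.b_pos s hs.1), abs_of_pos (h₂.b_pos s hs.1)]
    exact ⟨(hbℓ₁ s hs.1).trans ((hℓβ s hs.1).trans hβ1),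
      (hbℓ₂ s hs.1).trans ((hℓβ s hs.1).trans hβ1)⟩
  have key := fun s (hs : s ∈ Icc 0 t) =>
    hF _ _ _ _ _ _ m (j * β) (hR₁ s hs.1).1 (hR₁ s hs.1).2 (hb1 s hs).1 (hR₂ s hs.1).1
      (hR₂ s hs.1).2 (hb1 s hs).2 (hu s hs) (hv s hs)
      ((hb s hs).trans (mul_le_mul_of_nonneg_left (hℓβ s hs.1) hj0))
  have key₂ := fun s (hs : s ∈ Icc 0 t) =>
    hF _ _ _ _ _ _ 0 0 (hR₂ s hs.1).1 (hR₂ s hs.1).2 (hb1 s hs).2 (hR₂ s hs.1).1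
      (hR₂ s hs.1).2 (hb1 s hs).2 (by simp) (by simp) (by simp)
  have h0t : (0 : ℝ) ∈ Icc 0 t := ⟨le_rfl, ht⟩
  have hL : 0 ≤ L := (abs_nonneg _).trans (key 0 h0t).2.2.2.1
  have hjβ : j * β ≤ j := mul_le_of_le_one_right hj0 hβ1
  -- The difference of `1 / b` is controlled by that of `u + i v`, since `β` is small.
  have hjm : j ≤ 2 * L * m := by
    have h1 := image_norm_le_of_norm_deriv_right_le_deriv_boundary (a := 0) (b := t) (f := Y)
      (B := fun s => 3 / 2 * (L * (m + j * β)) * s) (B' := fun _ => 3 / 2 * (L * (m + j * β)))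
      (fun s hs => (hYd s hs.1).continuousAt.continuousWithinAt)
      (fun s hs => (hYd s hs.1).hasDerivWithinAt) (by simp [Y, hb₁, hb₂])
      (fun s => by simpa using (hasDerivAt_id s).const_mul (3 / 2 * (L * (m + j * β))))
      (fun s hs => by
        rw [← mul_sub, Real.norm_eq_abs, abs_mul, abs_of_pos (by norm_num : (0 : ℝ) < 3 / 2)]
        exact mul_le_mul_of_nonneg_left (key s (Ico_subset_Icc_self hs)).1 (by norm_num)) htj
    have h2 : j ≤ L * (m + j * β) := by
      rw [hj, div_le_iff₀ (hℓ0 _ htj.1), ← hj]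
      refine (Real.norm_eq_abs _ ▸ h1).trans ?_
      have h3 : 0 ≤ L * (m + j * β) := by positivity
      have h4 : 3 / 2 * tj ≤ ℓ tj := by
        have := inv_pos.2 hβ
        simp only [ℓ]; linarith
      have := mul_le_mul_of_nonneg_left h4 h3
      linarith
    nlinarith
  have hWU : ∀ s ∈ Icc 0 t, ‖W s - U s‖ ≤ β * (L * (m + j) / μ) := fun s hs => by
    have p1 := h₁.b_pos s hs.1
    have e : W s - U s = ((b₁ s * (hubbleFactor μ (u₁ s) (v₁ s) (b₁ s) * v₁ s -
        hubbleFactor μ (u₂ s) (v₂ s) (b₂ s) * v₂ s) +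
        (b₁ s - b₂ s) * (hubbleFactor μ (u₂ s) (v₂ s) (b₂ s) * v₂ s)) / (2 * μ) : ℝ) := by
      simp only [W, U, momentum]; push_cast; ring
    rw [e, Complex.norm_real, Real.norm_eq_abs, abs_div, abs_of_pos (mul_pos two_pos hμ)]
    have e2 : β * (L * (m + j) / μ) = (β * (L * (m + j)) + (j * β + β * m) * L) / (2 * μ) := by
      field_simp; ring
    rw [e2]
    refine div_le_div_of_nonneg_right ((abs_add_le _ _).trans (add_le_add ?_ ?_))
      (mul_pos two_pos hμ).le
    · rw [abs_mul, abs_of_pos p1]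
      refine mul_le_mul ((hbℓ₁ s hs.1).trans (hℓβ s hs.1)) ((key s hs).2.1.trans ?_)
        (abs_nonneg _) hβ.le
      gcongr
    · rw [abs_mul]
      refine mul_le_mul ?_ (key₂ s hs).2.2.2.1 (abs_nonneg _) (by positivity)
      have := mul_le_mul_of_nonneg_left (hℓβ s hs.1) hj0
      have := mul_nonneg hβ.le hm0
      linarith [hb s hs]
  have hZ : ∀ s ∈ Icc 0 t, ‖Z s - Z 0‖ ≤ β * (2 * L * (m + j)) := fun s hs => by
    -- The amplitudes change at a rate of order `b²`, whose integral is of order `β`.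
    have hB : ∀ r, 0 ≤ r → HasDerivAt (fun r => 2 * L * (m + j) * (β - (ℓ r)⁻¹))
        (3 * L * (m + j) * (ℓ r)⁻¹ ^ 2) r := fun r hr => by
      have h1 : HasDerivAt ℓ (3 / 2) r := by
        have := ((hasDerivAt_id r).const_mul (3 / 2 : ℝ)).const_add β⁻¹
        rwa [mul_one] at this
      refine (((h1.inv (hℓ0 r hr).ne').const_sub β).const_mul (2 * L * (m + j))).congr_deriv ?_
      have := (hℓ0 r hr).ne'
      field_simp
    have hd : ∀ r, 0 ≤ r → HasDerivAt (fun r => Z r - Z 0)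
        (Complex.exp (-(Complex.I * (μ * r : ℝ))) *
          (b₁ r ^ 2 * perturbation μ (u₁ r) (v₁ r) (b₁ r) -
            b₂ r ^ 2 * perturbation μ (u₂ r) (v₂ r) (b₂ r) : ℝ)) r := fun r hr => by
      refine (((h₁.hasDerivAt_amplitude hμ hr).sub
        (h₂.hasDerivAt_amplitude hμ hr)).sub_const (Z 0)).congr_deriv ?_
      push_cast; ring
    have h1 := image_norm_le_of_norm_deriv_right_le_deriv_boundary' (a := 0) (b := t)
      (f := fun r => Z r - Z 0) (B := fun r => 2 * L * (m + j) * (β - (ℓ r)⁻¹))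
      (fun r hr => (hd r hr.1).continuousAt.continuousWithinAt)
      (fun r hr => (hd r hr.1).hasDerivWithinAt) (by simp [ℓ])
      (fun r hr => (hB r hr.1).continuousAt.continuousWithinAt)
      (fun r hr => (hB r hr.1).hasDerivWithinAt) (fun r hr => ?_) hs
    · refine h1.trans ?_
      have h2 : 0 ≤ 2 * L * (m + j) := by positivity
      have := mul_nonneg h2 (inv_pos.2 (hℓ0 s hs.1)).le
      linarith
    · have hr' := Ico_subset_Icc_self hr
      have p1 := h₁.b_pos r hr.1
      have p2 := h₂.b_pos r hr.1
      have hl := (inv_pos.2 (hℓ0 r hr.1)).le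
      have q1 := hbℓ₁ r hr.1
      have q2 := hbℓ₂ r hr.1
      rw [norm_deriv_amplitude]
      have e : b₁ r ^ 2 * perturbation μ (u₁ r) (v₁ r) (b₁ r) -
          b₂ r ^ 2 * perturbation μ (u₂ r) (v₂ r) (b₂ r) =
          b₁ r ^ 2 * (perturbation μ (u₁ r) (v₁ r) (b₁ r) -
            perturbation μ (u₂ r) (v₂ r) (b₂ r)) +
          (b₁ r - b₂ r) * (b₁ r + b₂ r) * perturbation μ (u₂ r) (v₂ r) (b₂ r) := by ring
      have e2 : 3 * L * (m + j) * (ℓ r)⁻¹ ^ 2 = (ℓ r)⁻¹ ^ 2 * (L * (m + j)) +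
          ((j * (ℓ r)⁻¹) * ((ℓ r)⁻¹ + (ℓ r)⁻¹) * L + 2 * (ℓ r)⁻¹ ^ 2 * (L * m)) := by ring
      rw [e, e2]
      refine (abs_add_le _ _).trans (add_le_add ?_ (le_add_of_le_of_nonneg ?_ (by positivity)))
      · rw [abs_mul, abs_of_nonneg (sq_nonneg _)]
        refine mul_le_mul (pow_le_pow_left₀ p1.le q1 2) ((key r hr').2.2.1.trans ?_)
          (abs_nonneg _) (by positivity)
        gcongr
      · rw [abs_mul, abs_mul, abs_of_pos (add_pos p1 p2)]
        exact mul_le_mul (mul_le_mul (hb r hr') (add_le_add q1 q2) (add_pos p1 p2).le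
          (by positivity)) (key₂ r hr').2.2.2.2 (abs_nonneg _) (by positivity)
  have hZW : ∀ s, Z s = Complex.exp (-(Complex.I * (μ * s : ℝ))) * W s := fun s => by
    simp only [Z, W, amplitude]; ring
  have hZ0 : Z 0 = W 0 := by rw [hZW]; simp
  have hZn : ∀ s, ‖Z s‖ = ‖W s‖ := fun s => by
    have h : -(Complex.I * (μ * s : ℝ)) = ((-(μ * s) : ℝ) : ℂ) * Complex.I := by push_cast; ring
    rw [hZW, norm_mul, h, Complex.norm_exp_ofReal_mul_I, one_mul]
  have hfin : β * (L * (m + j) / μ) + β * (L * (m + j) / μ) + β * (2 * L * (m + j)) ≤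
      1 / 3 * m := by
    have e : β * (L * (m + j) / μ) + β * (L * (m + j) / μ) + β * (2 * L * (m + j)) =
        β * (L * (2 / μ + 2)) * (m + j) := by field_simp; ring
    rw [e]
    calc β * (L * (2 / μ + 2)) * (m + j) ≤ β * (L * (2 / μ + 2)) * (m + 2 * L * m) := by gcongr
      _ = β * (L * (2 / μ + 2) * (1 + 2 * L)) * m := by ring
      _ ≤ 1 / 3 * m := mul_le_mul_of_nonneg_right hβL' hm0
  have hW0 := hWU 0 h0t
  have hmU : m ≤ ‖U 0‖ + 1 / 3 * m := by
    have a1 := hWU tm htm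
    have a2 := hZ tm htm
    have a3 : ‖U tm‖ ≤ ‖W tm‖ + ‖W tm - U tm‖ := by
      have := norm_sub_le (W tm) (W tm - U tm)
      rwa [sub_sub_cancel] at this
    have a4 : ‖Z tm‖ ≤ ‖Z 0‖ + ‖Z tm - Z 0‖ := by
      have := norm_add_le (Z 0) (Z tm - Z 0)
      rwa [add_sub_cancel] at this
    have a5 : ‖W 0‖ ≤ ‖U 0‖ + ‖W 0 - U 0‖ := by
      have := norm_add_le (U 0) (W 0 - U 0)
      rwa [add_sub_cancel] at this
    rw [hZn, hZn] at a4
    linarith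
  change ‖Z t - U 0‖ ≤ 1 / 2 * ‖U 0‖
  have b1 := hZ t ⟨ht, le_rfl⟩
  rw [hZ0] at b1
  have b2 := norm_add_le (Z t - W 0) (W 0 - U 0)
  rw [sub_add_sub_cancel] at b2
  have b3 : 0 ≤ β * (L * (m + j) / μ) := by positivity
  linarith

/-- For each radius there is a threshold below which every value of `b` defines a section on which
the passage to the limit amplitude is close to the identity. -/
theorem exists_threshold (hμ : 0 < μ) (R : ℝ) : ∃ β₀, 0 < β₀ ∧ β₀ ≤ 1 ∧ ∀ β ≤ β₀,
    ∀ u₁ v₁ b₁ u₂ v₂ b₂ : ℝ → ℝ, ∀ ζ₁ ζ₂ : ℂ,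
    IsCosmicSolution μ u₁ v₁ b₁ → IsCosmicSolution μ u₂ v₂ b₂ → b₁ 0 = β → b₂ 0 = β →
    u₁ 0 ^ 2 + v₁ 0 ^ 2 ≤ R ^ 2 → u₂ 0 ^ 2 + v₂ 0 ^ 2 ≤ R ^ 2 →
    Tendsto (amplitude μ u₁ v₁ b₁) atTop (𝓝 ζ₁) → Tendsto (amplitude μ u₂ v₂ b₂) atTop (𝓝 ζ₂) →
    ‖(ζ₁ - ζ₂) - ((u₁ 0 + v₁ 0 * Complex.I) - (u₂ 0 + v₂ 0 * Complex.I))‖ ≤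
      1 / 2 * ‖((u₁ 0 + v₁ 0 * Complex.I) - (u₂ 0 + v₂ 0 * Complex.I) : ℂ)‖ := by
  obtain ⟨R', hR'⟩ := exists_bound hμ R
  obtain ⟨L₁, hL₁⟩ := exists_bound_lipschitz_of_contDiff (contDiff_hubbleFactor μ) R'
  obtain ⟨L₂, hL₂⟩ := exists_bound_lipschitz_of_contDiff
    (f := fun x => hubbleFactor μ x.1 x.2.1 x.2.2 * x.2.1)
    ((contDiff_hubbleFactor μ).mul (by fun_prop)) R'
  obtain ⟨L₃, hL₃⟩ := exists_bound_lipschitz_of_contDiff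
    (f := fun x => perturbation μ x.1 x.2.1 x.2.2) (by unfold perturbation; fun_prop) R'
  obtain ⟨L, hL⟩ : ∃ L, L = max 0 (max L₁ (max L₂ L₃)) := ⟨_, rfl⟩
  have hL0 : 0 ≤ L := hL ▸ le_max_left _ _
  have hL1 : L₁ ≤ L := hL ▸ (le_max_left _ _).trans (le_max_right _ _)
  have hL2 : L₂ ≤ L := hL ▸
    (le_max_left _ _).trans ((le_max_right _ _).trans (le_max_right _ _))
  have hL3 : L₃ ≤ L := hL ▸
    (le_max_right _ _).trans ((le_max_right _ _).trans (le_max_right _ _))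
  obtain ⟨M, hM⟩ : ∃ M, M = 1 + 2 * L + 3 * (L * (2 / μ + 2) * (1 + 2 * L)) := ⟨_, rfl⟩
  have hA : 0 ≤ L * (2 / μ + 2) * (1 + 2 * L) := by positivity
  have hMpos : 0 < M := by rw [hM]; positivity
  refine ⟨M⁻¹, inv_pos.2 hMpos, inv_le_one_of_one_le₀ (by linarith), ?_⟩
  intro β hβ u₁ v₁ b₁ u₂ v₂ b₂ ζ₁ ζ₂ h₁ h₂ hb₁ hb₂ hR₁ hR₂ hζ₁ hζ₂
  have hβ0 : 0 < β := hb₁ ▸ h₁.b_pos 0 le_rfl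
  have hβM : β * M ≤ 1 := by
    have := mul_le_mul_of_nonneg_right hβ hMpos.le
    rwa [inv_mul_cancel₀ hMpos.ne'] at this
  rw [hM] at hβM
  have hβ1 : β ≤ 1 := hβ.trans (inv_le_one_of_one_le₀ (by linarith))
  have c1 := mul_nonneg hβ0.le hL0
  have c2 := mul_nonneg hβ0.le hA
  refine le_of_tendsto (((hζ₁.sub hζ₂).sub_const _).norm) ?_
  filter_upwards [eventually_ge_atTop 0] with t ht
  refine norm_amplitude_sub_le hμ h₁ h₂ (L := L) (R := R') hβ1 (by nlinarith) (by nlinarith) hb₁ hb₂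
    (hR' _ _ _ h₁ (hb₁ ▸ hβ1) hR₁) (hR' _ _ _ h₂ (hb₂ ▸ hβ1) hR₂) ?_ ht
  intro u₁ v₁ b₁ u₂ v₂ b₂ m d a1 a2 a3 a4 a5 a6 a7 a8 a9
  have hmd : 0 ≤ m + d := add_nonneg ((abs_nonneg _).trans a7) ((abs_nonneg _).trans a9)
  have e1 := hL₁ u₁ v₁ b₁ u₂ v₂ b₂ m d a1 a2 a3 a4 a5 a6 a7 a8 a9
  have e2 := hL₂ u₁ v₁ b₁ u₂ v₂ b₂ m d a1 a2 a3 a4 a5 a6 a7 a8 a9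
  have e3 := hL₃ u₁ v₁ b₁ u₂ v₂ b₂ m d a1 a2 a3 a4 a5 a6 a7 a8 a9
  exact ⟨e1.1.trans (mul_le_mul_of_nonneg_right hL1 hmd),
    e2.1.trans (mul_le_mul_of_nonneg_right hL2 hmd),
    e3.1.trans (mul_le_mul_of_nonneg_right hL3 hmd), e2.2.trans hL2, e3.2.trans hL3⟩

end IsCosmicSolution

/-! ### From the states to cosmic time -/

/-- The variable `Σ_YM / √Ω_m`. -/
noncomputable def uVar (p : State) : ℝ := sigma p / √(OmegaM p)

/-- The variable `X₂ / √Ω_m`. -/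
noncomputable def vVar (p : State) : ℝ := X₂ p / √(OmegaM p)

/-- The variable `H √Ω_m`, with `H = ((1 - T) / T)²`; for dust it is proportional to `a^(-3/2)`. -/
noncomputable def bVar (p : State) : ℝ := lapse p ^ 2 * √(OmegaM p)

theorem bVar_pos {p : State} (hp : p ∈ fluidStates μ) : 0 < bVar p :=
  mul_pos (pow_pos (lapse_pos hp) 2) (Real.sqrt_pos.2 hp.2.2.2)

theorem hubbleFactor_eq (hμ : 0 < μ) {p : State} (hp : p ∈ fluidStates μ) :
    hubbleFactor μ (uVar p) (vVar p) (bVar p) = 1 / √(OmegaM p) := by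
  have hw := Real.sqrt_pos.2 hp.2.2.2
  have hw2 : √(OmegaM p) ^ 2 = OmegaM p := Real.sq_sqrt hp.2.2.2.le
  have hX := X₁_eq hμ hp
  refine (sq_eq_sq₀ (hubbleFactor_pos _ _ _ _).le (by positivity)).1 ?_
  rw [hubbleFactor_sq, uVar, vVar, bVar]
  have h1 : OmegaM p = 1 - (sigma p ^ 2 + (lapse p * X₂ p / μ) ^ 4 + X₂ p ^ 2) := by
    rw [← hX]; rfl
  generalize √(OmegaM p) = r at *
  rw [h1] at hw2
  field_simp
  field_simp at hw2
  linear_combination hw2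

theorem bVar_mul_hubbleFactor (hμ : 0 < μ) {p : State} (hp : p ∈ fluidStates μ) :
    bVar p * hubbleFactor μ (uVar p) (vVar p) (bVar p) = lapse p ^ 2 := by
  have hw := Real.sqrt_pos.2 hp.2.2.2
  rw [hubbleFactor_eq hμ hp, bVar]
  field_simp

theorem OmegaYM_eq (hμ : 0 < μ) {p : State} (hp : p ∈ fluidStates μ) :
    OmegaYM p = 1 - 1 / hubbleFactor μ (uVar p) (vVar p) (bVar p) ^ 2 := by
  rw [hubbleFactor_eq hμ hp, div_pow, Real.sq_sqrt hp.2.2.2.le, one_pow, one_div_one_div]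
  unfold OmegaM; ring

theorem hasDerivAt_sqrt_OmegaM {p : State} (hp : p ∈ fluidStates μ) (t : ℝ) :
    HasDerivAt (fun t => √(OmegaM (flow μ 1 p t))) (-((1 - T (flow μ 1 p t)) ^ 2 *
      √(OmegaM (flow μ 1 p t)) * (2 * X₂ (flow μ 1 p t) ^ 2 - OmegaYM (flow μ 1 p t)) / 2)) t := by
  have hw := (flow_mem (γ := 1) hp t).2.2.2
  have hr := Real.sqrt_pos.2 hw
  refine ((hasDerivAt_OmegaM_flow (γ := 1) hp t).sqrt hw.ne').congr_deriv ?_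
  have h2 : OmegaM (flow μ 1 p t) = √(OmegaM (flow μ 1 p t)) ^ 2 := (Real.sq_sqrt hw.le).symm
  generalize √(OmegaM (flow μ 1 p t)) = r at *
  rw [h2]
  field_simp
  ring

theorem hasDerivAt_bVar {p : State} (hp : p ∈ fluidStates μ) (t : ℝ) :
    HasDerivAt (fun t => bVar (flow μ 1 p t))
      (-(3 / 2) * (1 - T (flow μ 1 p t)) ^ 2 * bVar (flow μ 1 p t)) t := by
  refine (((hasDerivAt_lapse_flow (γ := 1) hp t).pow 2).mul
    (hasDerivAt_sqrt_OmegaM hp t)).congr_deriv ?_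
  simp only [Pi.pow_apply, bVar, q, OmegaM]
  push_cast
  ring

theorem hasDerivAt_uVar (hμ : 0 < μ) {p : State} (hp : p ∈ fluidStates μ) (t : ℝ) :
    HasDerivAt (fun t => uVar (flow μ 1 p t)) (T (flow μ 1 p t) ^ 2 *
      (-(μ * vVar (flow μ 1 p t)) - 1 / 2 * lapse (flow μ 1 p t) ^ 2 * uVar (flow μ 1 p t) -
        2 * bVar (flow μ 1 p t) ^ 2 * vVar (flow μ 1 p t) ^ 3 / μ ^ 3)) t := by
  have hm := flow_mem (γ := 1) hp t
  have hr := Real.sqrt_pos.2 hm.2.2.2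
  have hT := hm.2.1
  refine ((hasDerivAt_flow_components (γ := 1) hp t).1.div (hasDerivAt_sqrt_OmegaM hp t)
    hr.ne').congr_deriv ?_
  have hX := X₁_eq hμ hm
  have hε : 1 - T (flow μ 1 p t) = lapse (flow μ 1 p t) * T (flow μ 1 p t) := by
    unfold lapse; field_simp
  simp only [field, bVar, uVar, vVar, q, hX, hε]
  rw [show OmegaM (flow μ 1 p t) = 1 - OmegaYM (flow μ 1 p t) from rfl]
  field_simp
  ring

theorem hasDerivAt_vVar {p : State} (hp : p ∈ fluidStates μ) (t : ℝ) :
    HasDerivAt (fun t => vVar (flow μ 1 p t)) (T (flow μ 1 p t) ^ 2 *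
      (μ * uVar (flow μ 1 p t) + 1 / 2 * lapse (flow μ 1 p t) ^ 2 * vVar (flow μ 1 p t))) t := by
  have hm := flow_mem (γ := 1) hp t
  have hr := Real.sqrt_pos.2 hm.2.2.2
  have hT := hm.2.1
  refine ((hasDerivAt_flow_components (γ := 1) hp t).2.2.1.div (hasDerivAt_sqrt_OmegaM hp t)
    hr.ne').congr_deriv ?_
  have hε : 1 - T (flow μ 1 p t) = lapse (flow μ 1 p t) * T (flow μ 1 p t) := by
    unfold lapse; field_simp
  simp only [field, uVar, vVar, q, hε]
  rw [show OmegaM (flow μ 1 p t) = 1 - OmegaYM (flow μ 1 p t) from rfl]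
  field_simp
  ring

/-- A change of time `dt = g dτ` with a continuous rate bounded below by a positive constant. -/
theorem exists_time_change {g : ℝ → ℝ} (hg : Continuous g) {c : ℝ} (hc : 0 < c)
    (hgc : ∀ τ, c ≤ g τ) :
    ∃ s : ℝ ≃o ℝ, s 0 = 0 ∧ ∀ t, HasDerivAt s (g (s t))⁻¹ t := by
  let θ : ℝ → ℝ := fun τ => ∫ r in (0 : ℝ)..τ, g r
  have hd : ∀ τ, HasDerivAt θ (g τ) τ := fun τ =>
    intervalIntegral.integral_hasDerivAt_right (hg.intervalIntegrable _ _)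
      (hg.stronglyMeasurableAtFilter _ _) hg.continuousAt
  have h0 : θ 0 = 0 := intervalIntegral.integral_same
  have hmono : StrictMono θ := strictMono_of_deriv_pos fun τ => by
    rw [(hd τ).deriv]; exact hc.trans_le (hgc τ)
  have hcont : Continuous θ := continuous_iff_continuousAt.2 fun τ => (hd τ).continuousAt
  have hd' : ∀ τ, HasDerivAt (fun τ => θ τ - c * τ) (g τ - c) τ := fun τ => by
    exact ((hd τ).sub ((hasDerivAt_id τ).const_mul c)).congr_deriv (by simp)
  have hmono' : Monotone fun τ => θ τ - c * τ :=
    monotone_of_deriv_nonneg (fun τ => (hd' τ).differentiableAt) fun τ => by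
      rw [(hd' τ).deriv]; linarith [hgc τ]
  have htop : Tendsto θ atTop atTop := by
    refine tendsto_atTop_mono' _ ?_ (tendsto_id.const_mul_atTop hc)
    filter_upwards [eventually_ge_atTop 0] with τ hτ
    have := hmono' hτ
    simp only [h0, mul_zero, sub_zero, id] at this ⊢
    linarith
  have hbot : Tendsto θ atBot atBot := by
    refine tendsto_atBot_mono' _ ?_ (tendsto_id.const_mul_atBot hc)
    filter_upwards [eventually_le_atBot 0] with τ hτ
    have := hmono' hτ
    simp only [h0, mul_zero, sub_zero, id] at this ⊢
    linarith
  let e : ℝ ≃o ℝ := hmono.orderIsoOfSurjective θ (hcont.surjective htop hbot)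
  have he : ∀ t, θ (e.symm t) = t := fun t => e.apply_symm_apply t
  refine ⟨e.symm, ?_, fun t => ?_⟩
  · rw [OrderIso.symm_apply_eq]; exact h0.symm
  · exact HasDerivAt.of_local_left_inverse e.symm.continuous.continuousAt (hd _)
      (hc.trans_le (hgc _)).ne' (Eventually.of_forall he)

/-- For dust, every solution is, in cosmic time, a solution of the equations for `(u, v, b)`; it
has a limit amplitude `ζ`, and `Ω_YM / Ω_m` tends to `|ζ|²`. -/
theorem exists_cosmicSolution (hμ : 0 < μ) {p : State} (hp : p ∈ fluidStates μ) :
    ∃ (u v b : ℝ → ℝ) (ζ : ℂ), IsCosmicSolution μ u v b ∧ u 0 = uVar p ∧ v 0 = vVar p ∧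
      b 0 = bVar p ∧ Tendsto (IsCosmicSolution.amplitude μ u v b) atTop (𝓝 ζ) ∧
      Tendsto (fun τ => OmegaYM (flow μ 1 p τ)) atTop (𝓝 (1 - 1 / (‖ζ‖ ^ 2 + 1))) := by
  set x := flow μ 1 p with hx
  have hm : ∀ τ, x τ ∈ fluidStates μ := flow_mem hp
  -- The maximum with the initial value makes the rate `T²` bounded below on all of `ℝ`.
  let g : ℝ → ℝ := fun τ => max (T (x τ) ^ 2) (T p ^ 2)
  have hg : Continuous g :=
    ((continuous_T.comp (continuous_flow hp)).pow 2).max continuous_const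
  obtain ⟨s, hs0, hs⟩ := exists_time_change hg (pow_pos hp.2.1 2) fun τ => le_max_right _ _
  have hgT : ∀ t, 0 ≤ t → (g (s t))⁻¹ * T (x (s t)) ^ 2 = 1 := fun t ht => by
    have h1 : 0 ≤ s t := by rw [← hs0]; exact s.monotone ht
    have h2 := monotone_T_flow one_pos hp h1
    simp only [flow_zero] at h2
    have h3 : g (s t) = T (x (s t)) ^ 2 := max_eq_left (pow_le_pow_left₀ hp.2.1.le h2 2)
    rw [h3, inv_mul_cancel₀ (pow_pos (hm _).2.1 2).ne']
  have hsol : IsCosmicSolution μ (fun t => uVar (x (s t))) (fun t => vVar (x (s t)))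
      (fun t => bVar (x (s t))) := by
    refine ⟨fun t ht => ?_, fun t ht => ?_, fun t ht => ?_, fun t _ => bVar_pos (hm _)⟩
    · refine ((hasDerivAt_uVar hμ hp (s t)).comp t (hs t)).congr_deriv ?_
      rw [bVar_mul_hubbleFactor hμ (hm _)]
      linear_combination (-(μ * vVar (x (s t))) - 1 / 2 * lapse (x (s t)) ^ 2 * uVar (x (s t)) -
        2 * bVar (x (s t)) ^ 2 * vVar (x (s t)) ^ 3 / μ ^ 3) * hgT t ht
    · refine ((hasDerivAt_vVar hp (s t)).comp t (hs t)).congr_deriv ?_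
      rw [bVar_mul_hubbleFactor hμ (hm _)]
      linear_combination (μ * uVar (x (s t)) + 1 / 2 * lapse (x (s t)) ^ 2 * vVar (x (s t))) *
        hgT t ht
    · refine ((hasDerivAt_bVar hp (s t)).comp t (hs t)).congr_deriv ?_
      rw [bVar_mul_hubbleFactor hμ (hm _)]
      have hT := (hm (s t)).2.1.ne'
      have hε : 1 - T (x (s t)) = lapse (x (s t)) * T (x (s t)) := by
        unfold lapse; field_simp
      rw [← hx, hε]
      linear_combination (-(3 / 2) * lapse (x (s t)) ^ 2 * bVar (x (s t))) * hgT t ht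
  obtain ⟨ζ, hζ⟩ := hsol.exists_tendsto_amplitude hμ
  refine ⟨_, _, _, ζ, hsol, ?_, ?_, ?_, hζ, ?_⟩
  · simp only [hs0, hx, flow_zero]
  · simp only [hs0, hx, flow_zero]
  · simp only [hs0, hx, flow_zero]
  · have h1 := (((hsol.tendsto_energy hμ hζ).add_const 1).inv₀ (by positivity)).const_sub 1
    have h2 : Tendsto (fun t => OmegaYM (x (s t))) atTop (𝓝 (1 - 1 / (‖ζ‖ ^ 2 + 1))) := by
      rw [one_div]
      refine h1.congr fun t => ?_
      rw [OmegaYM_eq hμ (hm _), sub_add_cancel, one_div]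
    have h3 := h2.comp s.symm.tendsto_atTop
    exact h3.congr fun τ => by simp

/-! ### The sections `b = const` -/

/-- The state with given values of `b`, `u` and `v`. -/
noncomputable def sectionState (μ β u v : ℝ) : State :=
  (u / hubbleFactor μ u v β,
    √(β * hubbleFactor μ u v β) * (v / hubbleFactor μ u v β) / μ,
    v / hubbleFactor μ u v β, (1 + √(β * hubbleFactor μ u v β))⁻¹)

theorem lapse_sectionState {β : ℝ} (u v : ℝ) :
    lapse (sectionState μ β u v) = √(β * hubbleFactor μ u v β) := by
  have h : 0 < 1 + √(β * hubbleFactor μ u v β) := by positivity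
  simp only [lapse, T, sectionState]
  field_simp
  ring

theorem OmegaM_sectionState (hμ : 0 < μ) {β : ℝ} (hβ : 0 < β) (u v : ℝ) :
    OmegaM (sectionState μ β u v) = 1 / hubbleFactor μ u v β ^ 2 := by
  have hF := hubbleFactor_pos μ u v β
  have h4 : √(β * hubbleFactor μ u v β) ^ 4 = (β * hubbleFactor μ u v β) ^ 2 := by
    rw [show 4 = 2 * 2 from rfl, pow_mul, Real.sq_sqrt (mul_pos hβ hF).le]
  have hsq := hubbleFactor_sq μ u v β
  simp only [OmegaM, OmegaYM, sigma, X₁, X₂, sectionState]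
  rw [div_pow (√(β * hubbleFactor μ u v β) * _), mul_pow, h4]
  generalize hubbleFactor μ u v β = F at *
  field_simp
  field_simp at hsq
  linear_combination hsq

theorem sectionState_mem (hμ : 0 < μ) {β : ℝ} (hβ : 0 < β) (u v : ℝ) :
    sectionState μ β u v ∈ fluidStates μ := by
  have hF := hubbleFactor_pos μ u v β
  have hh : 0 < √(β * hubbleFactor μ u v β) := Real.sqrt_pos.2 (mul_pos hβ hF)
  refine ⟨?_, ?_, ?_, ?_⟩
  · simp only [T, X₁, X₂, sectionState]
    field_simp
    ring
  · simp only [T, sectionState]; positivity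
  · simp only [T, sectionState]
    exact inv_lt_one_of_one_lt₀ (by linarith)
  · rw [OmegaM_sectionState hμ hβ]; positivity

theorem sqrt_OmegaM_sectionState (hμ : 0 < μ) {β : ℝ} (hβ : 0 < β) (u v : ℝ) :
    √(OmegaM (sectionState μ β u v)) = 1 / hubbleFactor μ u v β := by
  have hF := hubbleFactor_pos μ u v β
  rw [OmegaM_sectionState hμ hβ, ← one_div_pow, Real.sqrt_sq (by positivity)]

theorem bVar_sectionState (hμ : 0 < μ) {β : ℝ} (hβ : 0 < β) (u v : ℝ) :
    bVar (sectionState μ β u v) = β := by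
  have hF := hubbleFactor_pos μ u v β
  rw [bVar, sqrt_OmegaM_sectionState hμ hβ, lapse_sectionState, Real.sq_sqrt (by positivity)]
  field_simp

theorem uVar_sectionState (hμ : 0 < μ) {β : ℝ} (hβ : 0 < β) (u v : ℝ) :
    uVar (sectionState μ β u v) = u := by
  have hF := hubbleFactor_pos μ u v β
  rw [uVar, sqrt_OmegaM_sectionState hμ hβ]
  simp only [sigma, sectionState]
  field_simp

theorem vVar_sectionState (hμ : 0 < μ) {β : ℝ} (hβ : 0 < β) (u v : ℝ) :
    vVar (sectionState μ β u v) = v := by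
  have hF := hubbleFactor_pos μ u v β
  rw [vVar, sqrt_OmegaM_sectionState hμ hβ]
  simp only [X₂, sectionState]
  field_simp

theorem sectionState_eq (hμ : 0 < μ) {p : State} (hp : p ∈ fluidStates μ) :
    sectionState μ (bVar p) (uVar p) (vVar p) = p := by
  have hw := Real.sqrt_pos.2 hp.2.2.2
  have hF := hubbleFactor_eq hμ hp
  have hl : √(bVar p * hubbleFactor μ (uVar p) (vVar p) (bVar p)) = lapse p := by
    rw [bVar_mul_hubbleFactor hμ hp, Real.sqrt_sq (lapse_pos hp).le]
  have hv : vVar p / hubbleFactor μ (uVar p) (vVar p) (bVar p) = X₂ p := by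
    rw [hF, vVar]; field_simp
  have hu : uVar p / hubbleFactor μ (uVar p) (vVar p) (bVar p) = sigma p := by
    rw [hF, uVar]; field_simp
  unfold sectionState
  rw [hl, hv, hu, ← X₁_eq hμ hp, ← T_eq hp]
  rfl

theorem continuous_sectionState (β : ℝ) :
    Continuous fun z : ℝ × ℝ => sectionState μ β z.1 z.2 := by
  have hF : Continuous fun z : ℝ × ℝ => hubbleFactor μ z.1 z.2 β := by
    unfold hubbleFactor; fun_prop
  have hF0 : ∀ z : ℝ × ℝ, hubbleFactor μ z.1 z.2 β ≠ 0 := fun z => (hubbleFactor_pos _ _ _ _).ne'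
  have hr : Continuous fun z : ℝ × ℝ => √(β * hubbleFactor μ z.1 z.2 β) :=
    (continuous_const.mul hF).sqrt
  have hv : Continuous fun z : ℝ × ℝ => z.2 / hubbleFactor μ z.1 z.2 β :=
    continuous_snd.div hF hF0
  refine (continuous_fst.div hF hF0).prodMk (((hr.mul hv).div_const μ).prodMk (hv.prodMk ?_))
  exact (continuous_const.add hr).inv₀ fun z =>
    (show 0 < 1 + √(β * hubbleFactor μ z.1 z.2 β) by positivity).ne'

theorem strictAnti_bVar {p : State} (hp : p ∈ fluidStates μ) :
    StrictAnti fun t => bVar (flow μ 1 p t) :=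
  strictAnti_of_deriv_neg fun t => by
    have hm := flow_mem (γ := 1) hp t
    rw [(hasDerivAt_bVar hp t).deriv]
    have h1 := mul_pos (pow_pos (sub_pos.2 hm.2.2.1) 2) (bVar_pos hm)
    linarith

/-- Every solution crosses every section `b = β > 0`. -/
theorem exists_bVar_eq {p : State} (hp : p ∈ fluidStates μ) {β : ℝ} (hβ : 0 < β) :
    ∃ t, bVar (flow μ 1 p t) = β := by
  have hm := flow_mem (γ := 1) hp
  have hc : Continuous fun t => bVar (flow μ 1 p t) :=
    continuous_iff_continuousAt.2 fun t => (hasDerivAt_bVar hp t).continuousAt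
  have htop : Tendsto (fun t => bVar (flow μ 1 p t)) atTop (𝓝 0) := by
    have h1 : Tendsto (fun t => lapse (flow μ 1 p t) ^ 2) atTop (𝓝 0) := by
      simpa using (tendsto_lapse_flow one_pos hp).pow 2
    refine squeeze_zero (fun t => (bVar_pos (hm t)).le) (fun t => ?_) h1
    exact mul_le_of_le_one_right (sq_nonneg _) (Real.sqrt_le_one.2 (OmegaM_le_one _))
  obtain ⟨c, hc0⟩ : ∃ c, c = 3 / 2 * (1 - T p) ^ 2 * bVar p := ⟨_, rfl⟩
  have hcpos : 0 < c := by
    have := mul_pos (pow_pos (sub_pos.2 hp.2.2.1) 2) (bVar_pos hp)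
    rw [hc0]; linarith
  -- In the past `1 - T` and `b` only grow, hence `b` grows at least linearly.
  have hd : ∀ t, HasDerivAt (fun t => bVar (flow μ 1 p t) + c * t)
      (-(3 / 2) * (1 - T (flow μ 1 p t)) ^ 2 * bVar (flow μ 1 p t) + c) t := fun t => by
    exact ((hasDerivAt_bVar hp t).add ((hasDerivAt_id t).const_mul c)).congr_deriv (by simp)
  have hanti : AntitoneOn (fun t => bVar (flow μ 1 p t) + c * t) (Iic 0) := by
    refine antitoneOn_of_hasDerivWithinAt_nonpos (convex_Iic _)
      (fun t _ => (hd t).continuousAt.continuousWithinAt) (fun t _ => (hd t).hasDerivWithinAt) ?_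
    intro t ht
    have ht' : t ∈ Iic (0 : ℝ) := interior_subset ht
    have h1 := monotone_T_flow one_pos hp ht'
    have h2 := (strictAnti_bVar hp).antitone ht'
    simp only [flow_zero] at h1 h2
    have h3 : (1 - T p) ^ 2 ≤ (1 - T (flow μ 1 p t)) ^ 2 :=
      pow_le_pow_left₀ (sub_pos.2 hp.2.2.1).le (by linarith) 2
    have := mul_le_mul h3 h2 (bVar_pos hp).le (sq_nonneg _)
    rw [hc0]; linarith
  have hβ' : β ≤ bVar (flow μ 1 p (-(β / c))) := by
    have hle : -(β / c) ≤ 0 := neg_nonpos.2 (div_pos hβ hcpos).le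
    have := hanti hle self_mem_Iic hle
    simp only [mul_zero, add_zero, flow_zero, mul_neg, mul_div_cancel₀ β hcpos.ne'] at this
    linarith [bVar_pos hp]
  obtain ⟨t₁, ht₁⟩ := (htop.eventually (gt_mem_nhds hβ)).exists
  exact mem_range_of_exists_le_of_exists_ge hc ⟨t₁, ht₁.le⟩ ⟨_, hβ'⟩

/-! ### The solutions that converge to an inner periodic orbit -/

/-- While `H` is small, `u² + v²` exceeds its limit `|ζ|²` at most by a constant factor. -/
theorem IsCosmicSolution.sq_add_sq_le_of_tendsto {u v b : ℝ → ℝ} (hμ : 0 < μ)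
    (h : IsCosmicSolution μ u v b) {ζ : ℂ}
    (hζ : Tendsto (IsCosmicSolution.amplitude μ u v b) atTop (𝓝 ζ)) {t : ℝ} (ht : 0 ≤ t)
    (h1 : driftConst μ * IsCosmicSolution.hubble μ u v b t ≤ 1)
    (h2 : IsCosmicSolution.hubble μ u v b t ≤ 2 * μ) : u t ^ 2 + v t ^ 2 ≤ 9 * ‖ζ‖ ^ 2 := by
  have hH := h.hubble_pos ht
  have hN := h.normSq_le_of_tendsto hμ hζ ht
  have he : Real.exp (driftConst μ * IsCosmicSolution.hubble μ u v b t) ≤ 3 :=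
    (Real.exp_le_exp.2 h1).trans (by linarith [Real.exp_one_lt_d9])
  have hN3 := hN.trans (mul_le_mul_of_nonneg_left he (sq_nonneg ‖ζ‖))
  obtain ⟨k, hk⟩ : ∃ k, k = IsCosmicSolution.hubble μ u v b t / (2 * μ) := ⟨_, rfl⟩
  have hk0 : 0 ≤ k := hk ▸ (by positivity)
  have hk1 : k ≤ 1 := hk ▸ (div_le_one (by positivity)).2 h2
  have hu : u t = IsCosmicSolution.momentum μ u v b t - k * v t := by
    rw [hk]; unfold IsCosmicSolution.momentum IsCosmicSolution.hubble; ring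
  have hkv : (k * v t) ^ 2 ≤ v t ^ 2 := by
    rw [mul_pow]; exact mul_le_of_le_one_left (sq_nonneg _) (pow_le_one₀ hk0 hk1)
  rw [hu]
  nlinarith [sq_nonneg (IsCosmicSolution.momentum μ u v b t + k * v t),
    sq_nonneg (IsCosmicSolution.momentum μ u v b t)]

/-- On a section `b = β` with `β` small, all solutions with limit amplitude `ζ` start in the disc of
radius `3 |ζ|`: otherwise `H` would later be equal to `H₁`, with an amplitude that makes it
smaller. -/
theorem IsCosmicSolution.initial_sq_add_sq_le {u v b : ℝ → ℝ} (hμ : 0 < μ)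
    (h : IsCosmicSolution μ u v b) {ζ : ℂ}
    (hζ : Tendsto (IsCosmicSolution.amplitude μ u v b) atTop (𝓝 ζ)) {H₁ : ℝ} (hH : 0 < H₁)
    (h1 : driftConst μ * H₁ ≤ 1) (h2 : H₁ ≤ 2 * μ) (hb : b 0 ≤ 1)
    (hβ : b 0 * √(1 + 9 * ‖ζ‖ ^ 2 + (9 * ‖ζ‖ ^ 2) ^ 2 / μ ^ 4) < H₁) :
    u 0 ^ 2 + v 0 ^ 2 ≤ 9 * ‖ζ‖ ^ 2 := by
  have hK := driftConst_pos hμ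
  have hle : IsCosmicSolution.hubble μ u v b 0 ≤ H₁ := by
    by_contra hlt
    rw [not_le] at hlt
    obtain ⟨t, ht, htH⟩ : ∃ t, 0 ≤ t ∧ IsCosmicSolution.hubble μ u v b t = H₁ := by
      obtain ⟨t₂, ht₂, ht₂H⟩ := ((eventually_ge_atTop (0 : ℝ)).and
        ((h.tendsto_hubble hμ).eventually (gt_mem_nhds hH))).exists
      obtain ⟨t, ht, htH⟩ := intermediate_value_Icc' ht₂
        (f := IsCosmicSolution.hubble μ u v b)
        (fun s hs => (h.hasDerivAt_hubble hμ hs.1).continuousAt.continuousWithinAt)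
        ⟨ht₂H.le, hlt.le⟩
      exact ⟨t, ht.1, htH⟩
    have hE := h.sq_add_sq_le_of_tendsto hμ hζ ht (htH ▸ h1) (htH ▸ h2)
    have hb0 := h.b_pos 0 le_rfl
    have hbt := h.b_pos t ht
    have hbt' : b t ≤ b 0 := by
      have := h.inv_b_ge ht
      exact (inv_le_inv₀ hb0 hbt).1 (by linarith)
    have hF : hubbleFactor μ (u t) (v t) (b t) ≤
        √(1 + 9 * ‖ζ‖ ^ 2 + (9 * ‖ζ‖ ^ 2) ^ 2 / μ ^ 4) := by
      refine Real.sqrt_le_sqrt ?_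
      have hv : v t ^ 2 ≤ 9 * ‖ζ‖ ^ 2 := by linarith [sq_nonneg (u t)]
      have hv4 : v t ^ 4 ≤ (9 * ‖ζ‖ ^ 2) ^ 2 := by
        have := pow_le_pow_left₀ (sq_nonneg (v t)) hv 2
        rwa [← pow_mul] at this
      have hb2 : b t ^ 2 ≤ 1 := pow_le_one₀ hbt.le (hbt'.trans hb)
      have : b t ^ 2 * v t ^ 4 / μ ^ 4 ≤ (9 * ‖ζ‖ ^ 2) ^ 2 / μ ^ 4 :=
        div_le_div_of_nonneg_right ((mul_le_of_le_one_left (by positivity) hb2).trans hv4)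
          (by positivity)
      linarith
    have := mul_le_mul hbt' hF (hubbleFactor_pos _ _ _ _).le hb0.le
    rw [← htH] at hβ
    exact absurd (this.trans_lt hβ) (lt_irrefl _)
  exact h.sq_add_sq_le_of_tendsto hμ hζ le_rfl
    ((mul_le_mul_of_nonneg_left hle hK.le).trans h1) (hle.trans h2)

theorem one_sub_one_div_eq_iff {ω r : ℝ} (hω : ω < 1) (hr : 0 ≤ r) :
    1 - 1 / (r + 1) = ω ↔ r = ω / (1 - ω) := by
  have h1 : 1 - ω ≠ 0 := by linarith
  have h2 : r + 1 ≠ 0 := by positivity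
  constructor
  · intro h
    field_simp at h ⊢
    linarith
  · rintro rfl
    field_simp
    ring

/-- For `γ = 1` the solutions that converge to `P_ω` are parametrized by the circle of their limit
amplitudes. -/
theorem exists_isOneParameterSet (hμ : 0 < μ) {ω : ℝ} (hω : 0 < ω) (hω' : ω < 1) :
    ∃ X : Circle → ℝ → State, IsOneParameterSet μ 1 (periodicOrbit ω) X := by
  obtain ⟨C, hC⟩ : ∃ C, C = √(ω / (1 - ω)) := ⟨_, rfl⟩
  have hCpos : 0 < C := hC ▸ Real.sqrt_pos.2 (div_pos hω (by linarith))
  have hC2 : C ^ 2 = ω / (1 - ω) := by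
    rw [hC, Real.sq_sqrt (div_pos hω (by linarith)).le]
  have hK := driftConst_pos hμ
  obtain ⟨β₀, hβ₀, hβ₀1, hthr⟩ := IsCosmicSolution.exists_threshold hμ (3 * C)
  obtain ⟨H₁, hH₁⟩ : ∃ H₁, H₁ = min (driftConst μ)⁻¹ (2 * μ) := ⟨_, rfl⟩
  have hH₁pos : 0 < H₁ := hH₁ ▸ lt_min (inv_pos.2 hK) (by positivity)
  have hH₁K : driftConst μ * H₁ ≤ 1 := by
    have := mul_le_mul_of_nonneg_left (hH₁ ▸ min_le_left _ _ : H₁ ≤ (driftConst μ)⁻¹) hK.le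
    rwa [mul_inv_cancel₀ hK.ne'] at this
  have hH₁μ : H₁ ≤ 2 * μ := hH₁ ▸ min_le_right _ _
  obtain ⟨η, hη⟩ : ∃ η, η = √(1 + 9 * C ^ 2 + (9 * C ^ 2) ^ 2 / μ ^ 4) := ⟨_, rfl⟩
  have hηpos : 0 < η := hη ▸ Real.sqrt_pos.2 (by positivity)
  -- The second bound on `β` makes `H < H₁` at all later points of the disc of radius `3 C`.
  obtain ⟨β, hβ⟩ : ∃ β, β = min β₀ (H₁ / (2 * η)) := ⟨_, rfl⟩
  have hβpos : 0 < β := hβ ▸ lt_min hβ₀ (by positivity)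
  have hββ₀ : β ≤ β₀ := hβ ▸ min_le_left _ _
  have hβη : β * η < H₁ := by
    have h1 : β ≤ H₁ / (2 * η) := hβ ▸ min_le_right _ _
    rw [le_div_iff₀ (by positivity)] at h1
    nlinarith
  -- The map from the section `b = β` to the limit amplitude.
  have hsol := fun U : ℂ =>
    exists_cosmicSolution hμ (sectionState_mem (μ := μ) hμ hβpos U.re U.im)
  choose u v b A hsol hu hv hb hA hΩ using hsol
  simp only [uVar_sectionState hμ hβpos, vVar_sectionState hμ hβpos,
    bVar_sectionState hμ hβpos] at hu hv hb
  have hUeq : ∀ U : ℂ, (u U 0 : ℂ) + v U 0 * Complex.I = U := fun U => by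
    rw [hu, hv]; exact Complex.re_add_im U
  have hdisc : ∀ U : ℂ, u U 0 ^ 2 + v U 0 ^ 2 = ‖U‖ ^ 2 := fun U => by
    rw [hu, hv, ← Complex.normSq_eq_norm_sq, Complex.normSq_apply]; ring
  have hmem : ∀ U ∈ Metric.closedBall (0 : ℂ) (3 * C), u U 0 ^ 2 + v U 0 ^ 2 ≤ (3 * C) ^ 2 :=
    fun U hU => by
      rw [hdisc]
      exact pow_le_pow_left₀ (norm_nonneg _) (mem_closedBall_zero_iff.1 hU) 2
  have hest : ∀ U ∈ Metric.closedBall (0 : ℂ) (3 * C), ∀ U' ∈ Metric.closedBall (0 : ℂ) (3 * C),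
      ‖(A U - A U') - (U - U')‖ ≤ 1 / 2 * ‖U - U'‖ := fun U hU U' hU' => by
    have := hthr β hββ₀ _ _ _ _ _ _ _ _ (hsol U) (hsol U') (hb U) (hb U') (hmem U hU)
      (hmem U' hU') (hA U) (hA U')
    rwa [hUeq, hUeq] at this
  -- Hence the inverse of this map is Lipschitz, and its preimages are unique.
  have hanti : ∀ U ∈ Metric.closedBall (0 : ℂ) (3 * C), ∀ U' ∈ Metric.closedBall (0 : ℂ) (3 * C),
      ‖U - U'‖ ≤ 2 * ‖A U - A U'‖ := fun U hU U' hU' => by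
    have h1 := hest U hU U' hU'
    have h2 := norm_sub_le (A U - A U') ((A U - A U') - (U - U'))
    rw [sub_sub_cancel] at h2
    linarith
  have hA0 : A 0 = 0 := by
    have h1 := (hsol 0).norm_limit_le hμ (hA 0)
    have h2 : v 0 0 = 0 := by rw [hv]; rfl
    have h3 : IsCosmicSolution.momentum μ (u 0) (v 0) (b 0) 0 = 0 := by
      unfold IsCosmicSolution.momentum
      rw [h2, hu]; simp
    rw [h2, h3] at h1
    have h4 : ‖A 0‖ = 0 := by
      have : ‖A 0‖ ^ 2 ≤ 0 := by simpa using h1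
      exact pow_eq_zero_iff (two_ne_zero) |>.1 (le_antisymm this (sq_nonneg _))
    exact norm_eq_zero.1 h4
  have hsurj : SurjOn A (Metric.closedBall 0 (3 * C)) (Metric.closedBall 0 C) := by
    have happ : ApproximatesLinearOn A (ContinuousLinearMap.id ℝ ℂ) (Metric.closedBall 0 (3 * C))
        (1 / 2) := by
      intro U hU U' hU'
      simpa using hest U hU U' hU'
    let r : (ContinuousLinearMap.id ℝ ℂ).NonlinearRightInverse :=
      ⟨id, 1, fun y => by simp, fun y => rfl⟩
    have := happ.surjOn_closedBall_of_nonlinearRightInverse r (ε := 3 * C) (b := 0)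
      (by positivity) subset_rfl
    rw [hA0] at this
    refine this.mono subset_rfl (Metric.closedBall_subset_closedBall ?_)
    simp only [r]
    norm_num
    linarith
  have hnorm : ∀ θ : Circle, ‖(C * θ : ℂ)‖ = C := fun θ => by
    rw [norm_mul, Complex.norm_real, Real.norm_of_nonneg hCpos.le, Circle.norm_coe, mul_one]
  have hpre : ∀ θ : Circle, ∃ U ∈ Metric.closedBall (0 : ℂ) (3 * C), A U = C * θ := fun θ =>
    hsurj (mem_closedBall_zero_iff.2 (hnorm θ).le)
  choose V hV hAV using hpre
  have hVc : Continuous V := by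
    refine continuous_iff_continuousAt.2 fun θ => tendsto_iff_norm_sub_tendsto_zero.2 ?_
    have hc : Continuous fun θ' : Circle => 2 * ‖(C * θ' : ℂ) - C * θ‖ := by
      have : Continuous fun θ' : Circle => (θ' : ℂ) := continuous_subtype_val
      fun_prop
    refine squeeze_zero (fun _ => norm_nonneg _) (fun θ' => ?_) (by simpa using hc.tendsto θ)
    have := hanti _ (hV θ') _ (hV θ)
    rwa [hAV, hAV] at this
  let P : Circle → State := fun θ => sectionState μ β (V θ).re (V θ).im
  have hPc : Continuous P := (continuous_sectionState β).comp
    ((Complex.continuous_re.comp hVc).prodMk (Complex.continuous_im.comp hVc))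
  have hPm : ∀ θ, P θ ∈ fluidStates μ := fun θ => sectionState_mem hμ hβpos _ _
  have hPb : ∀ θ, bVar (P θ) = β := fun θ => bVar_sectionState hμ hβpos _ _
  have hVne : ∀ θ, V θ ≠ 0 := fun θ hθ => by
    have h1 := hAV θ
    rw [hθ, hA0] at h1
    have h2 := hnorm θ
    rw [← h1, norm_zero] at h2
    exact hCpos.ne h2
  have hP : ∀ θ, P θ ∈ twoFluidStates μ := fun θ => by
    refine mem_twoFluidStates_iff.2 ⟨hPm θ, ?_⟩
    have h1 : 0 < ‖V θ‖ ^ 2 := pow_pos (norm_pos_iff.2 (hVne θ)) 2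
    rw [← hdisc, hu, hv] at h1
    have hF := hubbleFactor_sq μ (V θ).re (V θ).im β
    have h2 : 0 ≤ β ^ 2 * (V θ).im ^ 4 / μ ^ 4 := by positivity
    have h3 : 1 / hubbleFactor μ (V θ).re (V θ).im β ^ 2 < 1 := by
      rw [div_lt_one (pow_pos (hubbleFactor_pos _ _ _ _) 2), hF]
      linarith
    have h4 := OmegaM_sectionState hμ hβpos (V θ).re (V θ).im
    unfold OmegaM at h4
    simp only [P]
    linarith
  refine ⟨fun θ => flow μ 1 (P θ), continuous_flow_comp hPc hPm, fun θ =>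
    ⟨isSolutionOn_flow (hP θ), ?_⟩, ?_⟩
  · refine convergesToOrbit_of_tendsto_flow hμ one_pos hω (hPm θ) ?_
    have h1 := hΩ (V θ)
    rwa [(one_sub_one_div_eq_iff hω' (sq_nonneg _)).2 (by rw [hAV, hnorm, hC2])] at h1
  · intro τ₀ x hx hconv
    have hp : x τ₀ ∈ fluidStates μ := twoFluidStates_subset (hx τ₀ self_mem_Ici).1
    obtain ⟨t₀, ht₀⟩ := exists_bVar_eq hp hβpos
    obtain ⟨p, hpdef⟩ : ∃ p, p = flow μ 1 (x τ₀) t₀ := ⟨_, rfl⟩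
    have hpm : p ∈ fluidStates μ := hpdef ▸ flow_mem hp t₀
    have hpb : bVar p = β := hpdef ▸ ht₀
    obtain ⟨U, hU⟩ : ∃ U : ℂ, U = ⟨uVar p, vVar p⟩ := ⟨_, rfl⟩
    have hpU : sectionState μ β U.re U.im = p := by
      rw [hU, ← hpb]; exact sectionState_eq hμ hpm
    -- The limit of `Ω_YM` fixes the modulus of the limit amplitude.
    have hlim : Tendsto (fun τ => OmegaYM (flow μ 1 p τ)) atTop (𝓝 ω) := by
      have h1 := tendsto_OmegaYM_of_convergesToOrbit hω.le hconv
      refine (h1.comp (tendsto_atTop_add_const_right _ (τ₀ + t₀) tendsto_id)).congr' ?_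
      filter_upwards [eventually_ge_atTop (-t₀)] with τ hτ
      simp only [Function.comp_apply, id]
      rw [hx.eq_flow (by linarith), hpdef, flow_add hp]
      congr 2
      ring
    have hAU : ‖A U‖ = C := by
      have h1 := hΩ U
      rw [hpU] at h1
      have h2 := (one_sub_one_div_eq_iff hω' (sq_nonneg _)).1 (tendsto_nhds_unique h1 hlim)
      rw [← hC2] at h2
      exact (sq_eq_sq₀ (norm_nonneg _) hCpos.le).1 h2
    have hUmem : U ∈ Metric.closedBall (0 : ℂ) (3 * C) := by
      have h1 := (hsol U).initial_sq_add_sq_le hμ (hA U) hH₁pos hH₁K hH₁μ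
        (by rw [hb]; exact hββ₀.trans hβ₀1) (by rw [hAU, ← hη, hb]; exact hβη)
      rw [hdisc, hAU] at h1
      rw [mem_closedBall_zero_iff]
      exact abs_le_of_sq_le_sq (by linarith) (by positivity) |> (le_abs_self _).trans
    have hC0 : (C : ℂ) ≠ 0 := Complex.ofReal_ne_zero.2 hCpos.ne'
    let θ : Circle := ⟨A U / C, by
      rw [Submonoid.unitSphere, ← SetLike.mem_coe]
      refine mem_sphere_zero_iff_norm.2 ?_
      rw [norm_div, hAU, Complex.norm_real, Real.norm_of_nonneg hCpos.le, div_self hCpos.ne']⟩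
    have hθ : (C * θ : ℂ) = A U := mul_div_cancel₀ (A U) hC0
    have hUV : U = V θ := by
      have := hanti _ hUmem _ (hV θ)
      rw [hAV, hθ, sub_self, norm_zero, mul_zero] at this
      exact sub_eq_zero.1 (norm_le_zero_iff.1 this)
    have hpP : P θ = p := by simp only [P, ← hUV, hpU]
    refine ⟨(θ, -(τ₀ + t₀)), fun τ hτ => ?_, ?_⟩
    · simp only
      rw [hx.eq_flow hτ, hpP, hpdef, flow_add hp]
      congr 1
      ring
    · rintro ⟨θ', s'⟩ h'
      have h1 := h' τ₀ self_mem_Ici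
      simp only at h1
      have h2 : p = flow μ 1 (P θ') (τ₀ + s' + t₀) := by
        rw [hpdef, h1, flow_add (hPm θ')]
      have h3 : τ₀ + s' + t₀ = 0 := by
        refine (strictAnti_bVar (hPm θ')).injective ?_
        simp only [flow_zero]
        rw [← h2, hpb, hPb]
      rw [h3, flow_zero] at h2
      have h4 : V θ' = U := by
        rw [hU, h2]
        exact Complex.ext (uVar_sectionState hμ hβpos _ _).symm
          (vVar_sectionState hμ hβpos _ _).symm
      have h5 : (θ' : ℂ) = θ := by
        have := hAV θ'
        rw [h4, ← hθ] at this
        exact (mul_left_cancel₀ hC0 this).symm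
      exact Prod.ext (Circle.ext h5) (by simp only; linarith)

end MassiveYM

theorem mainTheorem3 (μ γ : ℝ) (hμ : 0 < μ) (hγ : 0 < γ) (hγ' : γ ≤ 2) :
    (∀ p ∈ MassiveYM.twoFluidStates μ,
      ∃ x : ℝ → MassiveYM.State, MassiveYM.IsSolutionOn μ γ x univ ∧ x 0 = p) ∧
    (1 < γ → ∀ (τ₀ : ℝ) (x : ℝ → MassiveYM.State), MassiveYM.IsSolutionOn μ γ x (Ici τ₀) →
      MassiveYM.ConvergesToOrbit x (MassiveYM.periodicOrbit 1)) ∧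
    (γ < 1 → ∀ (τ₀ : ℝ) (x : ℝ → MassiveYM.State), MassiveYM.IsSolutionOn μ γ x (Ici τ₀) →
      Tendsto x atTop (𝓝 MassiveYM.FL₁)) ∧
    (γ = 1 → ∀ ω : ℝ, 0 < ω → ω < 1 →
      ∃ X : Circle → ℝ → MassiveYM.State,
        MassiveYM.IsOneParameterSet μ γ (MassiveYM.periodicOrbit ω) X) := by
  refine ⟨fun p hp => ⟨MassiveYM.flow μ γ p, MassiveYM.isSolutionOn_flow hp,
    MassiveYM.flow_zero p⟩, fun h τ₀ x hx => MassiveYM.convergesToOrbit_one hμ h hγ' hx,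
    fun h τ₀ x hx => MassiveYM.tendsto_FL₁ hμ hγ h hx, ?_⟩
  rintro rfl ω hω hω'
  exact MassiveYM.exists_isOneParameterSet hμ hω hω'
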